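/- **Setting.** Let $M$ be a finite Markov decision process: a finite directed graph $(S,E)$ in which every state has a successor, a partition $S=S_1\uplus S_2$ into states of player 1 and stochastic states, and for each $s\in S_2$ a probability distribution $\delta(s)$ whose support is the set of successors of $s$. A strategy $\lambda$ (of player 1) maps each finite path ending in some $s\in S_1$ to a distribution on the successors of $s$. Write $s,\lambda\models \mathsf{S}(A)$ if every play from $s$ consistent with $\lambda$ lies in $A$, and $s,\lambda\models\mathsf{AS}(A)$ if the play from $s$ under $\lambda$ lies in $A$ with probability $1$. For a play $\pi$, $\inf(\pi)$ is the set of states occurring infinitely often. Let $p_1,p_2:S\to\mathbb N$ be priority functions; $p_i$ also denotes the event $\{\pi : \max_{s\in\inf(\pi)}p_i(s)\text{ is even}\}$, and $\Diamond T$ is the event that $T$ is visited. An end-component is a non-empty set $C\subseteq S$ that is strongly connected (any two of its states are joined by a path inside $C$), contains all successors of its stochastic states, and contains a successor of each of its player-1 states; $M_{\downharpoonright C}$ is the MDP restricted to $C$. Put $$C^{\max}_{\rm even}(p_i)=\{s\in C : p_i(s)\text{ even, and } p_i(t)<p_i(s)\text{ for all }t\in C\text{ with }p_i(t)\text{ odd}\}.$$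 The end-component $C$ is *ultra-good* if in $M_{\downharpoonright C}$ * $(1_U)$ for each $s\in C$ some $\lambda$ satisfies $s,\lambda\models \mathsf S(p_1)$ and $s,\lambda\models\mathsf{AS}(\Diamond C^{\max}_{\rm even}(p_1))$; * $(2_U)$ for each $s\in C$ some $\lambda$ satisfies $s,\lambda\models \mathsf{AS}(p_1)$ and $s,\lambda\models\mathsf{AS}(p_2)$. **Data.** For an ultra-good end-component $C$ consider: * a strategy $\lambda_{1}$ of $M_{\downharpoonright C}$ that is a witness for $(1_U)$ from every $s\in C$; * a memoryless (randomized) strategy $\lambda_{2}$ of $M_{\downharpoonright C}$ that is a witness for $(2_U)$ from every $s\in C$, and an end-component $D\subseteq C$ with $D^{\max}_{\rm even}(p_1)\ne\emptyset$ and $D^{\max}_{\rm even}(p_2)\neq\emptyset$, such that under $\lambda_{2}$, from every $s\in C$, $\inf(\pi)=D$ with probability $1$; * natural numbers $(n_i)_{i\ge 0}$, with $n_i\ge1$ for $i\ge 1$, such that for all $i\geq 0$ and $s\in C$, under $\lambda_{2}$ from $s$, the probability that $\pi(j)\in D^{\max}_{\rm even}(p_1)$ for some $0\le j\le n_i$ is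 at least $1-2^{-i}$. The strategy $\lambda_C$ is played as follows, starting with $i=0$. * (a) Play $\lambda_{2}$ for $n_i$ steps. Then increase $i$ by $1$ and go to (b). * (b) If $D^{\max}_{\rm even}(p_1)$ was visited in the phase (a) just finished (in one of its $n_{i-1}+1$ states, first and last included), go to (a). Otherwise play $\lambda_{1}$, started afresh in the current state, until $C^{\max}_{\rm even}(p_1)$ is reached, and then go to (a). **Lemma.** Let $C$ be an ultra-good end-component of $M$. Then data $\lambda_{1},\lambda_{2},D,(n_i)$ as above exist, and for every choice of them the resulting strategy $\lambda_C$ satisfies, for all $s\in C$, $$s,\lambda_C\models \mathsf S(p_1)\quad\text{and}\quad s,\lambda_C\models\mathsf{AS}(p_2),$$ both in $M_{\downharpoonright C}$ and in $M$ (where $\lambda_C$ is extended to the finite paths that are not inside $C$ by choosing some successor there; no such path occurs from $s\in C$). -/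

import Mathlib

open MeasureTheory ProbabilityTheory
open scoped ENNReal

/-- A Markov decision process on the state space `S`: a non-blocking directed graph with edge
relation `E`, a set `S₁` of states of player 1 (all other states are stochastic, i.e. belong to
player 2), and for each stochastic state a distribution whose support is the set of successors. -/
structure FinMDP (S : Type*) where
  E : S → S → Prop
  nonblocking : ∀ s, ∃ t, E s t
  S₁ : Set S
  δ : {s : S // s ∉ S₁} → PMF S
  support_δ : ∀ s, (δ s).support = {t | E s t}

/-- Restriction of a distribution to a set that contains its support. -/
noncomputable def restrictPMF {S : Type*} (p : PMF S) (C : Set S) (h : p.support ⊆ C) : PMF C :=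
  ⟨fun t => p t, (hasSum_subtype_iff_of_support_subset h).2 p.2⟩

namespace FinMDP

variable {S : Type*}

/-- The list `π 0, …, π (n - 1)`. -/
def past (π : ℕ → S) (n : ℕ) : List S := List.ofFn fun i : Fin n => π i

/-- The plays of the underlying graph. -/
def plays (M : FinMDP S) : Set (ℕ → S) := {π | ∀ n, M.E (π n) (π (n + 1))}

/-- A (randomized, history-dependent) strategy of player 1. For a prefix `ρ · s` ending in
`s ∈ S₁`, the distribution on the next state is `act ρ s`. Values of `act` at states outside `S₁`
are never used. -/
structure Strategy (M : FinMDP S) where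
  act : List S → S → PMF S
  support_act : ∀ ρ s, s ∈ M.S₁ → (act ρ s).support ⊆ {t | M.E s t}

/-- The strategy depends on the current state only. -/
def Strategy.IsMemoryless {M : FinMDP S} (σ : M.Strategy) : Prop :=
  ∀ ρ s, σ.act ρ s = σ.act [] s

/-- The plays from `s` that are consistent with `σ`. -/
def out (M : FinMDP S) (σ : M.Strategy) (s : S) : Set (ℕ → S) :=
  {π | π ∈ M.plays ∧ π 0 = s ∧
    ∀ n, π n ∈ M.S₁ → π (n + 1) ∈ (σ.act (past π n) (π n)).support}

open Classical in
/-- Distribution of the next state after the prefix `ρ · s`. -/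
noncomputable def next (M : FinMDP S) (σ : M.Strategy) (ρ : List S) (s : S) : PMF S :=
  if h : s ∈ M.S₁ then σ.act ρ s else M.δ ⟨s, h⟩

section Probability

variable [Finite S] [MeasurableSpace S] [MeasurableSingletonClass S]

/-- `next` as a transition kernel from the prefixes of length `n + 1`. -/
noncomputable def stepKernel (M : FinMDP S) (σ : M.Strategy) (n : ℕ) :
    Kernel ((i : Finset.Iic n) → (fun _ : ℕ => S) i) S :=
  Kernel.ofFunOfCountable fun x =>
    (M.next σ
      (List.ofFn fun i : Fin n => x ⟨i, Finset.mem_Iic.2 i.2.le⟩)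
      (x ⟨n, Finset.mem_Iic.2 le_rfl⟩)).toMeasure

instance (M : FinMDP S) (σ : M.Strategy) (n : ℕ) : IsMarkovKernel (M.stepKernel σ n) where
  isProbabilityMeasure x := by
    change IsProbabilityMeasure (PMF.toMeasure _)
    infer_instance

/-- The law of the random play that starts in `s` when player 1 uses `σ`, as a measure on the
sequences of states with the product σ-algebra. -/
noncomputable def prob (M : FinMDP S) (σ : M.Strategy) (s : S) : Measure (ℕ → S) :=
  Kernel.traj (X := fun _ : ℕ => S) (M.stepKernel σ) 0 fun _ => s

/-- `s, σ ⊨ AS(A)`: the event `A` has probability one. -/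
def AlmostSure (M : FinMDP S) (σ : M.Strategy) (s : S) (A : Set (ℕ → S)) : Prop :=
  M.prob σ s A = 1

end Probability

/-- `s, σ ⊨ S(A)`: every consistent play from `s` lies in `A`. -/
def Sure (M : FinMDP S) (σ : M.Strategy) (s : S) (A : Set (ℕ → S)) : Prop :=
  M.out σ s ⊆ A

/-- The states that occur infinitely often. -/
def infSet (π : ℕ → S) : Set S := {s | ∀ i, ∃ j ≥ i, π j = s}

/-- Reachability objective. -/
def reach (T : Set S) : Set (ℕ → S) := {π | ∃ n, π n ∈ T}

/-- Parity objective: the maximal priority that is seen infinitely often is even. -/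
def parity (p : S → ℕ) : Set (ℕ → S) := {π | ∃ m, IsGreatest (p '' infSet π) m ∧ Even m}

/-- End-components: non-empty strongly connected traps for player 2. -/
structure IsEC (M : FinMDP S) (C : Set S) : Prop where
  nonempty : C.Nonempty
  stochastic_closed : ∀ s ∈ C, s ∉ M.S₁ → ∀ t, M.E s t → t ∈ C
  player_stays : ∀ s ∈ C, s ∈ M.S₁ → ∃ t ∈ C, M.E s t
  connected : ∀ s ∈ C, ∀ t ∈ C, Relation.ReflTransGen (fun x y => x ∈ C ∧ y ∈ C ∧ M.E x y) s t

/-- The sub-MDP on an end-component. -/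
noncomputable def sub (M : FinMDP S) {C : Set S} (hC : M.IsEC C) : FinMDP C where
  E s t := M.E s t
  nonblocking s := by
    by_cases h : (s : S) ∈ M.S₁
    · obtain ⟨t, ht, hst⟩ := hC.player_stays s s.2 h
      exact ⟨⟨t, ht⟩, hst⟩
    · obtain ⟨t, hst⟩ := M.nonblocking s
      exact ⟨⟨t, hC.stochastic_closed s s.2 h t hst⟩, hst⟩
  S₁ := {s | (s : S) ∈ M.S₁}
  δ s := restrictPMF (M.δ ⟨s.1, s.2⟩) C (by
    rw [M.support_δ]
    exact fun t ht => hC.stochastic_closed s.1 s.1.2 s.2 t ht)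
  support_δ s := by
    ext t
    have h := Set.ext_iff.1 (M.support_δ ⟨s.1, s.2⟩) t
    exact h

/-- The states of `C` with an even priority that exceeds every odd priority in `C`. -/
def maxEven (p : S → ℕ) (C : Set S) : Set S :=
  {s | s ∈ C ∧ Even (p s) ∧ ∀ t ∈ C, Odd (p t) → p t < p s}

section UltraGood

variable [Finite S] [MeasurableSpace S] [MeasurableSingletonClass S]

/-- Ultra-good end-components. In the sub-MDP on `C` the set of all states is `C`, so that
`maxEven _ Set.univ` there is the set `maxEven p₁ C`. -/
def IsUltraGood (M : FinMDP S) (p₁ p₂ : S → ℕ) {C : Set S} (hC : M.IsEC C) : Prop :=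
  (∀ s : C, ∃ σ : (M.sub hC).Strategy,
    (M.sub hC).Sure σ s (parity fun c : C => p₁ c) ∧
    (M.sub hC).AlmostSure σ s (reach (maxEven (fun c : C => p₁ c) Set.univ))) ∧
  (∀ s : C, ∃ σ : (M.sub hC).Strategy,
    (M.sub hC).AlmostSure σ s (parity fun c : C => p₁ c) ∧
    (M.sub hC).AlmostSure σ s (parity fun c : C => p₂ c))

/-- `σ` is a uniform witness, in the MDP `N`, for surely satisfying `p₁` and almost surely
visiting the maximal even states. -/
def IsFirstWitness (N : FinMDP S) (p₁ : S → ℕ) (σ : N.Strategy) : Prop :=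
  ∀ s, N.Sure σ s (parity p₁) ∧ N.AlmostSure σ s (reach (maxEven p₁ Set.univ))

/-- `σ` is a uniform memoryless witness, in the MDP `N`, for almost surely satisfying `p₁` and
`p₂`, under which almost surely the set of states seen infinitely often is the end-component `D`,
whose maximal priorities are even. -/
def IsSecondWitness (N : FinMDP S) (p₁ p₂ : S → ℕ) (σ : N.Strategy) (D : Set S) : Prop :=
  σ.IsMemoryless ∧
  (∀ s, N.AlmostSure σ s (parity p₁) ∧ N.AlmostSure σ s (parity p₂)) ∧
  N.IsEC D ∧ (maxEven p₁ D).Nonempty ∧ (maxEven p₂ D).Nonempty ∧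
  ∀ s, N.prob σ s {π | infSet π = D} = 1

/-- Within `n i` steps of `σ`, from every state, the set `T` is visited with probability at least
`1 - 2⁻ⁱ`. Rounds after the initial one have at least one step. -/
def IsRoundLengths (N : FinMDP S) (σ : N.Strategy) (T : Set S) (n : ℕ → ℕ) : Prop :=
  (∀ i, 1 ≤ i → 1 ≤ n i) ∧
  ∀ i s, 1 - (2⁻¹ : ℝ≥0∞) ^ i ≤ N.prob σ s {π | ∃ j ≤ n i, π j ∈ T}

end UltraGood

/-- Memory of the round-based strategy: the current phase (a) or (b), the round counter `i`, and
the list of the states in which a move of the current phase has been made. -/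
inductive Phase (S : Type*) where
  | a (i : ℕ) (g : List S)
  | b (i : ℕ) (g : List S)

open Classical in
/-- Change of phase on arrival in `s`. Phase (a) of round `i` is over after `n i` steps; then the
counter is increased, and the next phase (a) starts in `s` if `T` was visited in the phase that has
just ended (in one of its `n i + 1` states, `s` included), and phase (b) starts otherwise. Phase
(b) is over as soon as `U` is reached; if `s ∈ U` this is at once, without a move. -/
noncomputable def Phase.settle (T U : Set S) (n : ℕ → ℕ) : Phase S → S → Phase S
  | .a i g, s =>
      if g.length < n i then .a i g
      else if (∃ x ∈ g ++ [s], x ∈ T) ∨ s ∈ U then .a (i + 1) []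
      else .b (i + 1) []
  | .b i g, s => if s ∈ U then .a i [] else .b i g

/-- The current phase after a move from `s`. -/
def Phase.push : Phase S → S → Phase S
  | .a i g, s => .a i (g ++ [s])
  | .b i g, s => .b i (g ++ [s])

/-- The memory after the prefix `ρ`. -/
noncomputable def Phase.after (T U : Set S) (n : ℕ → ℕ) (ρ : List S) : Phase S :=
  ρ.foldl (fun m s => (m.settle T U n s).push s) (.a 0 [])

/-- The round-based strategy: play `σ₂` in the phases (a) and `σ₁` in the phases (b), each time
afresh from the state in which the phase starts. -/
noncomputable def Strategy.rounds {N : FinMDP S} (σ₁ σ₂ : N.Strategy) (T U : Set S) (n : ℕ → ℕ) :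
    N.Strategy where
  act ρ s :=
    match (Phase.after T U n ρ).settle T U n s with
    | .a _ g => σ₂.act g s
    | .b _ g => σ₁.act g s
  support_act ρ s hs := by
    split
    · exact σ₂.support_act _ s hs
    · exact σ₁.support_act _ s hs

open Classical in
/-- A strategy of the sub-MDP on `C` as a strategy of `M`: it is followed on the prefixes inside
`C`, and some successor is chosen on all other prefixes. -/
noncomputable def Strategy.extend {M : FinMDP S} {C : Set S} {hC : M.IsEC C}
    (σ : (M.sub hC).Strategy) : M.Strategy where
  act ρ s :=
    if h : (∀ x ∈ ρ, x ∈ C) ∧ s ∈ C then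
      (σ.act (ρ.pmap Subtype.mk h.1) ⟨s, h.2⟩).map Subtype.val
    else PMF.pure (M.nonblocking s).choose
  support_act ρ s hs := by
    split
    · next h =>
      rw [PMF.support_map]
      rintro _ ⟨t, ht, rfl⟩
      exact σ.support_act _ _ hs ht
    · intro t ht
      rw [PMF.support_pure, Set.mem_singleton_iff] at ht
      rw [ht]
      exact (M.nonblocking s).choose_spec

end FinMDP

/-!
Everything probabilistic is derived from a one-step decomposition of the law of a play
(`prob_eq_sum`): the first move is drawn from `next`, and the rest is the law for the shifted
strategy. It yields, by induction on a time horizon, a conditional Borel-Cantelli lemma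
(`ae_frequently`): if on every history in a set `A` the state `t` comes next with probability at
least `ε > 0`, then almost surely `t` occurs infinitely often when `A` does.

*Existence of the data.* Almost surely the recurrent states of a play form an end-component
(`ae_isEC_infSet`). Under a witness for the second condition a typical play therefore has an
end-component `D` as its set of recurrent states, and the maximal priorities of `D` are even. The
memoryless strategy that moves uniformly inside `D`, and uniformly among all successors outside
`D`, almost surely has `D` as its set of recurrent states, because the recurrent states are closed
under the edges of the induced chain and `D` is reachable from everywhere. The round lengths exist
by continuity of measure and finiteness.

*Sure satisfaction of the first objective* (`sure_rounds`). Consider a consistent play. If the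
maximal even states of the whole component recur, they decide the objective. Otherwise, either a
phase (b) lasts forever, and the play has a suffix consistent with the first strategy; or from some
time on there are only phases (a), each of which visits the maximal even states of `D`. As `D` is
closed under the second strategy, the play then ends up in `D` and visits these states infinitely
often.

*Almost sure satisfaction of the second objective* (`almostSure_rounds`). A superharmonic function
(`potential`) shows that phase (b) of round `j + 1` is entered with probability at most `2⁻ʲ`
(`prob_exists_b_le`), so by Borel-Cantelli only finitely many rounds have a phase (b), and each of
these phases ends almost surely (`ae_b_ends`). Hence from some time on the second strategy is
played throughout. By the conditional Borel-Cantelli lemma the recurrent states are closed under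
the edges of its chain, which forces them to be `D` (`infSet_eq_of_closed`).

*From the sub-MDP to the MDP.* A consistent play of the extended strategy never leaves the
component, and its law is the image of the law in the sub-MDP (`prob_extend`).
-/

namespace FinMDP

variable {S : Type*}

/-! ### Histories and plays -/

/-- The play `s · π`. -/
def cons (s : S) (π : ℕ → S) : ℕ → S
  | 0 => s
  | n + 1 => π n

@[simp] theorem cons_zero (s : S) (π : ℕ → S) : cons s π 0 = s := rfl

@[simp] theorem cons_succ (s : S) (π : ℕ → S) (n : ℕ) : cons s π (n + 1) = π n := rfl

@[simp] theorem past_zero (π : ℕ → S) : past π 0 = [] := by simp [past]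

theorem past_succ (π : ℕ → S) (n : ℕ) : past π (n + 1) = past π n ++ [π n] := by
  simp only [past, List.ofFn_succ', List.concat_eq_append, Fin.val_castSucc, Fin.val_last]

@[simp] theorem past_cons (s : S) (π : ℕ → S) (n : ℕ) :
    past (cons s π) (n + 1) = s :: past π n := by
  simp [past, List.ofFn_succ]

theorem past_congr {π ρ : ℕ → S} {n : ℕ} (h : ∀ i < n, π i = ρ i) : past π n = past ρ n := by
  unfold past
  congr 1
  funext i
  exact h i i.2

theorem next_mem (M : FinMDP S) (σ : M.Strategy) (ρ : List S) (s : S) :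
    ∀ t, M.next σ ρ s t ≠ 0 → M.E s t := by
  intro t ht
  unfold next at ht
  split at ht
  · next h => exact σ.support_act ρ s h ((PMF.mem_support_iff _ _).2 ht)
  · next h =>
    have : t ∈ (M.δ ⟨s, h⟩).support := (PMF.mem_support_iff _ _).2 ht
    rwa [M.support_δ] at this

/-- Consistency in terms of `next`, which treats the states of both players alike. -/
theorem mem_out_iff (M : FinMDP S) (σ : M.Strategy) (s : S) (π : ℕ → S) :
    π ∈ M.out σ s ↔ π 0 = s ∧ ∀ n, M.next σ (past π n) (π n) (π (n + 1)) ≠ 0 := by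
  constructor
  · rintro ⟨h1, h2, h3⟩
    refine ⟨h2, fun n => ?_⟩
    unfold next
    split
    · next h => exact (PMF.mem_support_iff _ _).1 (h3 n h)
    · next h =>
      rw [← PMF.mem_support_iff, M.support_δ]
      exact h1 n
  · rintro ⟨h1, h2⟩
    refine ⟨fun n => M.next_mem σ _ _ _ (h2 n), h1, fun n hn => ?_⟩
    have := h2 n
    unfold next at this
    rw [dif_pos hn] at this
    exact (PMF.mem_support_iff _ _).2 this

/-- The strategy `σ` after the first move has been made in `s`. -/
noncomputable def Strategy.shift {M : FinMDP S} (σ : M.Strategy) (s : S) : M.Strategy where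
  act ρ u := σ.act (s :: ρ) u
  support_act ρ u hu := σ.support_act (s :: ρ) u hu

theorem next_shift {M : FinMDP S} (σ : M.Strategy) (s : S) (ρ : List S) (u : S) :
    M.next (σ.shift s) ρ u = M.next σ (s :: ρ) u := rfl

theorem Strategy.IsMemoryless.shift_eq {M : FinMDP S} {σ : M.Strategy} (h : σ.IsMemoryless)
    (s : S) : σ.shift s = σ := by
  obtain ⟨act, hact⟩ := σ
  simp only [Strategy.shift, Strategy.mk.injEq]
  funext ρ u
  exact (h (s :: ρ) u).trans (h ρ u).symm

theorem Strategy.IsMemoryless.next_eq {M : FinMDP S} {σ : M.Strategy} (h : σ.IsMemoryless)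
    (ρ : List S) (s : S) : M.next σ ρ s = M.next σ [] s := by
  unfold next
  rw [h ρ s]

theorem past_cons_pred (w : ℕ → S) (n : ℕ) :
    past w (n + 1) = w 0 :: past (fun i => w (i + 1)) n := by
  simp [past, List.ofFn_succ]

/-- The plays that agree with `w` up to time `n`. -/
def cyl (w : ℕ → S) (n : ℕ) : Set (ℕ → S) := {π | ∀ i ≤ n, π i = w i}

theorem cyl_eq_preimage (w : ℕ → S) (n : ℕ) :
    cyl w n = Preorder.frestrictLe (π := fun _ : ℕ => S) n ⁻¹'
      {Preorder.frestrictLe (π := fun _ : ℕ => S) n w} := by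
  ext π
  simp only [cyl, Set.mem_ofPred_eq, Set.mem_preimage, Set.mem_singleton_iff, funext_iff,
    Preorder.frestrictLe_apply, Subtype.forall, Finset.mem_Iic]

theorem cons_preimage_cyl_succ (w : ℕ → S) (n : ℕ) (s : S) (h : w 0 = s) :
    cons s ⁻¹' cyl w (n + 1) = cyl (fun i => w (i + 1)) n := by
  ext π
  constructor
  · intro hπ i hi
    exact hπ (i + 1) (by omega)
  · rintro hπ (_ | i) hi
    · exact h.symm
    · exact hπ i (by omega)

/-! ### The law of the play -/

theorem _root_.PMF.tsum_mul_le (p : PMF S) (f : S → ℝ≥0∞) (c : ℝ≥0∞) (h : ∀ t, p t ≠ 0 → f t ≤ c) :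
    ∑' t, p t * f t ≤ c := by
  calc ∑' t, p t * f t ≤ ∑' t, p t * c := by
        refine ENNReal.tsum_le_tsum fun t => ?_
        by_cases ht : p t = 0
        · simp [ht]
        · gcongr; exact h t ht
    _ = c := by rw [ENNReal.tsum_mul_right, PMF.tsum_coe, one_mul]

theorem measurable_cons [MeasurableSpace S] (s : S) : Measurable (cons s) := by
  refine measurable_pi_lambda _ fun n => ?_
  cases n with
  | zero => exact measurable_const
  | succ n => exact measurable_pi_apply n

section Probability

variable [Finite S] [MeasurableSpace S] [MeasurableSingletonClass S]

instance (M : FinMDP S) (σ : M.Strategy) (s : S) : IsProbabilityMeasure (M.prob σ s) := by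
  unfold prob; infer_instance

/-- A set of plays that is determined by finitely many coordinates is measurable. -/
theorem measurableSet_of_dependsOn {P : (ℕ → S) → Prop} (n : ℕ)
    (h : ∀ π ρ : ℕ → S, (∀ i < n, π i = ρ i) → P π → P ρ) : MeasurableSet {π | P π} := by
  have hm : Measurable (fun (π : ℕ → S) (i : Fin n) => π i) :=
    measurable_pi_lambda _ fun i => measurable_pi_apply _
  have : {π | P π} = (fun (π : ℕ → S) (i : Fin n) => π i) ⁻¹'
      ((fun (π : ℕ → S) (i : Fin n) => π i) '' {π | P π}) := by
    refine Set.Subset.antisymm (Set.subset_preimage_image _ _) ?_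
    rintro ρ ⟨π, hπ, hπρ⟩
    exact h π ρ (fun i hi => congrFun hπρ ⟨i, hi⟩) hπ
  rw [this]
  exact hm (Set.toFinite _).measurableSet

theorem measurableSet_history (n : ℕ) (A : List S → S → Prop) :
    MeasurableSet {π : ℕ → S | A (past π n) (π n)} := by
  refine measurableSet_of_dependsOn (n + 1) fun π ρ h hA => ?_
  rwa [← past_congr fun i hi => h i (by omega), ← h n (by omega)]

theorem measurableSet_coord (n : ℕ) (s : S) : MeasurableSet {π : ℕ → S | π n = s} :=
  measurableSet_history n fun _ x => x = s

theorem measurableSet_cyl (w : ℕ → S) (n : ℕ) : MeasurableSet (cyl w n) :=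
  measurableSet_of_dependsOn (n + 1) fun π ρ h hA i hi => by
    rw [← h i (by omega)]; exact hA i hi

/-- Finite measures on plays are determined by the cylinders. -/
theorem measure_ext_cyl {μ ν : Measure (ℕ → S)} [IsFiniteMeasure μ] [IsFiniteMeasure ν]
    (h : ∀ w n, μ (cyl w n) = ν (cyl w n)) : μ = ν := by
  have key : ∀ n, μ.map (Preorder.frestrictLe (π := fun _ : ℕ => S) n) =
      ν.map (Preorder.frestrictLe (π := fun _ : ℕ => S) n) := by
    intro n
    refine Measure.ext_of_singleton fun x => ?_
    by_cases hx : ∃ w : ℕ → S, Preorder.frestrictLe (π := fun _ : ℕ => S) n w = x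
    · obtain ⟨w, rfl⟩ := hx
      rw [Measure.map_apply (Preorder.measurable_frestrictLe n) (measurableSet_singleton _),
        Measure.map_apply (Preorder.measurable_frestrictLe n) (measurableSet_singleton _),
        ← cyl_eq_preimage, h]
    · exfalso
      refine hx ⟨fun i => if hi : i ≤ n then x ⟨i, Finset.mem_Iic.2 hi⟩ else
        x ⟨n, Finset.mem_Iic.2 le_rfl⟩, ?_⟩
      funext i
      simp [Finset.mem_Iic.1 i.2]
  refine IsProjectiveLimit.unique (P := fun I : Finset ℕ => μ.map I.restrict) ?_ ?_
  · intro I; rfl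
  · intro I
    have hI : I ⊆ Finset.Iic (I.sup id) := I.subset_Iic_sup_id
    change ν.map I.restrict = μ.map I.restrict
    rw [← Finset.restrict₂_comp_restrict hI, ← Measure.map_map (by fun_prop) (by fun_prop),
      ← Measure.map_map (by fun_prop) (by fun_prop)]
    congr 1
    exact (key _).symm

open Classical in
/-- The probability of a cylinder is the product of the transition probabilities. -/
theorem prob_cyl (M : FinMDP S) (σ : M.Strategy) (s : S) (w : ℕ → S) (n : ℕ) :
    M.prob σ s (cyl w n) = (if w 0 = s then 1 else 0) *
      ∏ i ∈ Finset.range n, M.next σ (past w i) (w i) (w (i + 1)) := by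
  induction n with
  | zero =>
    rw [cyl_eq_preimage, prob, ← Measure.map_apply (Preorder.measurable_frestrictLe 0)
      (measurableSet_singleton _), Kernel.traj_map_frestrictLe_apply, Kernel.partialTraj_self,
      Kernel.id_apply, Measure.dirac_apply' _ (measurableSet_singleton _), Finset.range_zero,
      Finset.prod_empty, mul_one, Set.indicator_apply]
    congr 1
    simp only [Set.mem_singleton_iff, funext_iff, Subtype.forall, Finset.mem_Iic,
      Preorder.frestrictLe_apply, eq_iff_iff]
    constructor
    · intro h; exact (h 0 le_rfl).symm
    · intro h i hi
      obtain rfl : i = 0 := by omega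
      exact h.symm
  | succ n ih =>
    have h1 : cyl w (n + 1) = (fun x : ℕ → S =>
        (Preorder.frestrictLe (π := fun _ : ℕ => S) n x, x (n + 1))) ⁻¹'
        ({Preorder.frestrictLe (π := fun _ : ℕ => S) n w} ×ˢ {w (n + 1)}) := by
      rw [Set.mk_preimage_prod, ← cyl_eq_preimage]
      ext π
      simp only [cyl, Set.mem_ofPred_eq, Set.mem_inter_iff, Set.mem_preimage,
        Set.mem_singleton_iff]
      constructor
      · intro h; exact ⟨fun i hi => h i (by omega), h _ le_rfl⟩
      · rintro ⟨h, h'⟩ i hi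
        rcases Nat.lt_or_ge n i with hl | hl
        · obtain rfl : i = n + 1 := by omega
          exact h'
        · exact h i hl
    have h2 := Kernel.partialTraj_compProd_eq_map_traj (X := fun _ : ℕ => S)
      (κ := M.stepKernel σ) (Nat.zero_le n) (x₀ := fun _ => s)
    rw [Finset.prod_range_succ, ← mul_assoc, ← ih, h1, cyl_eq_preimage w n, prob,
      ← Measure.map_apply (by fun_prop)
        ((measurableSet_singleton _).prod (measurableSet_singleton _)),
      ← h2, Measure.compProd_apply_prod (measurableSet_singleton _) (measurableSet_singleton _),
      lintegral_singleton, ← Measure.map_apply (by fun_prop) (measurableSet_singleton _),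
      Kernel.traj_map_frestrictLe_apply, mul_comm]
    congr 1
    exact PMF.toMeasure_apply_singleton _ _ (measurableSet_singleton _)

/-- The Markov property at time one: the first move is drawn from `next`, and the rest of the play
follows the shifted strategy. -/
theorem prob_eq_sum (M : FinMDP S) (σ : M.Strategy) (s : S) :
    M.prob σ s = Measure.sum fun t =>
      M.next σ [] s t • (M.prob (σ.shift s) t).map (cons s) := by
  classical
  have happ : ∀ A : Set (ℕ → S), MeasurableSet A →
      (Measure.sum fun t => M.next σ [] s t • (M.prob (σ.shift s) t).map (cons s)) A =
      ∑' t, M.next σ [] s t * M.prob (σ.shift s) t (cons s ⁻¹' A) := by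
    intro A hA
    rw [Measure.sum_apply _ hA]
    simp only [Measure.smul_apply, Measure.map_apply (measurable_cons s) hA, smul_eq_mul]
  have : IsFiniteMeasure (Measure.sum fun t =>
      M.next σ [] s t • (M.prob (σ.shift s) t).map (cons s)) := by
    refine ⟨?_⟩
    rw [happ _ MeasurableSet.univ]
    simp [PMF.tsum_coe]
  refine measure_ext_cyl fun w n => ?_
  rw [happ _ (measurableSet_cyl w n)]
  by_cases hw : w 0 = s
  · cases n with
    | zero =>
      rw [prob_cyl, if_pos hw]
      have : cons s ⁻¹' cyl w 0 = Set.univ := by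
        refine Set.eq_univ_of_forall fun π i hi => ?_
        obtain rfl : i = 0 := by omega
        exact hw.symm
      simp [this, PMF.tsum_coe]
    | succ n =>
      rw [prob_cyl, if_pos hw, one_mul, Finset.prod_range_succ', tsum_eq_single (w 1)]
      · rw [cons_preimage_cyl_succ w n s hw, prob_cyl, if_pos rfl, one_mul, mul_comm, past_zero, hw]
        congr 1
        refine Finset.prod_congr rfl fun i _ => ?_
        rw [next_shift, past_cons_pred, hw]
      · intro t ht
        rw [cons_preimage_cyl_succ w n s hw, prob_cyl, if_neg (Ne.symm ht)]
        simp
  · rw [prob_cyl, if_neg hw, zero_mul]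
    have : cons s ⁻¹' cyl w n = ∅ := by
      refine Set.eq_empty_of_forall_notMem fun π hπ => hw (hπ 0 (Nat.zero_le _)).symm
    simp [this]

theorem prob_apply (M : FinMDP S) (σ : M.Strategy) (s : S) {A : Set (ℕ → S)}
    (hA : MeasurableSet A) :
    M.prob σ s A = ∑' t, M.next σ [] s t * M.prob (σ.shift s) t (cons s ⁻¹' A) := by
  conv_lhs => rw [prob_eq_sum]
  rw [Measure.sum_apply _ hA]
  simp only [Measure.smul_apply, Measure.map_apply (measurable_cons s) hA, smul_eq_mul]

/-- An almost sure property of the plays from `s` may be checked after the first move. -/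
theorem ae_of_shift (M : FinMDP S) (σ : M.Strategy) (s : S) {P : (ℕ → S) → Prop}
    (hP : MeasurableSet {π | P π})
    (h : ∀ t, M.next σ [] s t ≠ 0 → ∀ᵐ π ∂M.prob (σ.shift s) t, P (cons s π)) :
    ∀ᵐ π ∂M.prob σ s, P π := by
  rw [ae_iff]
  change M.prob σ s {π | P π}ᶜ = 0
  rw [prob_apply M σ s hP.compl, ENNReal.tsum_eq_zero]
  intro t
  by_cases ht : M.next σ [] s t = 0
  · simp [ht]
  · rw [show M.prob (σ.shift s) t (cons s ⁻¹' {π | P π}ᶜ) = 0 from ae_iff.1 (h t ht), mul_zero]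

/-- The law of the play from `s` depends only on the moves on histories that start in `s`. -/
theorem prob_congr {M : FinMDP S} {σ τ : M.Strategy} {s : S}
    (h₀ : M.next σ [] s = M.next τ [] s)
    (h : ∀ ρ u, M.next σ (s :: ρ) u = M.next τ (s :: ρ) u) : M.prob σ s = M.prob τ s := by
  have h' : ∀ t, M.prob (σ.shift s) t = M.prob (τ.shift s) t := by
    intro t
    refine measure_ext_cyl fun w n => ?_
    rw [prob_cyl, prob_cyl]
    simp only [next_shift, h]
  rw [prob_eq_sum, prob_eq_sum M τ, h₀]
  simp only [h']

/-- Almost every play is consistent with the strategy. -/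
theorem ae_mem_out (M : FinMDP S) (σ : M.Strategy) (s : S) : ∀ᵐ π ∂M.prob σ s, π ∈ M.out σ s := by
  simp only [mem_out_iff, Filter.eventually_and, ae_all_iff]
  have h0 : ∀ (σ : M.Strategy) s, ∀ᵐ π ∂M.prob σ s, π 0 = s := fun σ s =>
    ae_of_shift M σ s (measurableSet_coord 0 s) fun t _ => Filter.Eventually.of_forall fun π => rfl
  refine ⟨h0 σ s, fun n => ?_⟩
  have hm : ∀ (σ : M.Strategy) (n : ℕ),
      MeasurableSet {π : ℕ → S | M.next σ (past π n) (π n) (π (n + 1)) ≠ 0} := fun σ n =>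
    measurableSet_of_dependsOn (n + 2) fun π ρ h hA => by
      rwa [← past_congr fun i hi => h i (by omega), ← h n (by omega), ← h (n + 1) (by omega)]
  induction n generalizing σ s with
  | zero =>
    refine ae_of_shift M σ s (hm σ 0) fun t ht => ?_
    filter_upwards [h0 (σ.shift s) t] with π hπ
    simpa [hπ] using ht
  | succ n ih =>
    refine ae_of_shift M σ s (hm σ (n + 1)) fun t _ => ?_
    filter_upwards [ih (σ.shift s) t] with π hπ
    simpa [next_shift] using hπ

/-! ### A conditional Borel-Cantelli lemma -/

open Classical in
/-- If on every history in `A` the next state is `t` with probability at least `ε`, then the first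
`N` moves include at least `k` moves from histories in `A`, but none to `t`, with probability at most
`(1 - ε) ^ k`. -/
theorem prob_count_le (M : FinMDP S) (t : S) (ε : ℝ≥0∞) (N : ℕ) : ∀ (k : ℕ) (σ : M.Strategy)
    (A : List S → S → Prop), (∀ ρ s, A ρ s → ε ≤ M.next σ ρ s t) → ∀ s,
    M.prob σ s {π | k ≤ Nat.count (fun n => A (past π n) (π n)) N ∧ ∀ n < N, π (n + 1) ≠ t} ≤
      (1 - ε) ^ k := by
  induction N with
  | zero =>
    intro k σ A _ s
    rcases Nat.eq_zero_or_pos k with rfl | hk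
    · simp
    · simp [hk.ne']
  | succ N ih =>
    intro k σ A hA s
    have hm : MeasurableSet {π : ℕ → S | k ≤ Nat.count (fun n => A (past π n) (π n)) (N + 1) ∧
        ∀ n < N + 1, π (n + 1) ≠ t} := by
      refine measurableSet_of_dependsOn (N + 2) fun π ρ h hh => ?_
      have e : ∀ n < N + 1, (A (past π n) (π n) ↔ A (past ρ n) (ρ n)) := fun n hn => by
        rw [← past_congr fun i hi => h i (by omega), ← h n (by omega)]
      refine ⟨hh.1.trans_eq ?_, fun n hn => by rw [← h (n + 1) (by omega)]; exact hh.2 n hn⟩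
      rw [Nat.count_eq_card_filter_range, Nat.count_eq_card_filter_range]
      congr 1
      exact Finset.filter_congr fun n hn => e n (Finset.mem_range.1 hn)
    rw [prob_apply M σ s hm]
    have hsub : cons s ⁻¹' {π : ℕ → S | k ≤ Nat.count (fun n => A (past π n) (π n)) (N + 1) ∧
        ∀ n < N + 1, π (n + 1) ≠ t} ⊆ {π | (k - if A [] s then 1 else 0) ≤
          Nat.count (fun n => A (s :: past π n) (π n)) N ∧ ∀ n < N, π (n + 1) ≠ t} := by
      rintro π ⟨h1, h2⟩
      refine ⟨?_, fun n hn => h2 (n + 1) (by omega)⟩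
      rw [Nat.count_succ'] at h1
      simp only [past_zero, cons_zero, past_cons, cons_succ] at h1
      omega
    by_cases hs : A [] s
    · rcases Nat.eq_zero_or_pos k with rfl | hk
      · rw [pow_zero]
        exact PMF.tsum_mul_le _ _ _ fun u _ => prob_le_one
      obtain ⟨k, rfl⟩ : ∃ j, k = j + 1 := ⟨k - 1, by omega⟩
      have hz : ∀ u, M.next σ [] s u * M.prob (σ.shift s) u (cons s ⁻¹' {π : ℕ → S |
          k + 1 ≤ Nat.count (fun n => A (past π n) (π n)) (N + 1) ∧
          ∀ n < N + 1, π (n + 1) ≠ t}) ≤ (if u = t then 0 else M.next σ [] s u) * (1 - ε) ^ k := by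
        intro u
        split
        · next hu =>
          have h0 : ∀ᵐ π ∂M.prob (σ.shift s) u, π 0 = u := by
            filter_upwards [ae_mem_out M (σ.shift s) u] with π hπ using hπ.2.1
          have : M.prob (σ.shift s) u (cons s ⁻¹' {π : ℕ → S |
              k + 1 ≤ Nat.count (fun n => A (past π n) (π n)) (N + 1) ∧
              ∀ n < N + 1, π (n + 1) ≠ t}) = 0 := by
            refine measure_mono_null ?_ (ae_iff.1 h0)
            rintro π ⟨_, h2⟩ h0
            exact h2 0 (by omega) (h0.trans hu)
          rw [this, mul_zero, zero_mul]
        · gcongr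
          refine (measure_mono hsub).trans ?_
          rw [if_pos hs]
          exact ih k (σ.shift s) (fun ρ x => A (s :: ρ) x) (fun ρ x hx => hA _ _ hx) u
      refine (ENNReal.tsum_le_tsum hz).trans ?_
      rw [ENNReal.tsum_mul_right, pow_succ']
      gcongr
      -- A first move that avoids `t` has probability at most `1 - ε`.
      refine ENNReal.le_sub_of_add_le_right
        (ne_top_of_le_ne_top ENNReal.one_ne_top ((hA [] s hs).trans (PMF.coe_le_one _ _))) ?_
      calc (∑' u, if u = t then 0 else M.next σ [] s u) + ε
          ≤ (∑' u, if u = t then 0 else M.next σ [] s u) +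
            ∑' u, (if u = t then M.next σ [] s u else 0) := by
            gcongr
            rw [tsum_ite_eq]
            exact hA [] s hs
        _ = ∑' u, M.next σ [] s u := by
            rw [← ENNReal.tsum_add]
            refine tsum_congr fun u => ?_
            split <;> simp
        _ = 1 := PMF.tsum_coe _
    · refine PMF.tsum_mul_le _ _ _ fun u _ => (measure_mono hsub).trans ?_
      rw [if_neg hs, Nat.sub_zero]
      exact ih k (σ.shift s) (fun ρ x => A (s :: ρ) x) (fun ρ x hx => hA _ _ hx) u

theorem measurableSet_frequently (A : List S → S → Prop) :
    MeasurableSet {π : ℕ → S | ∀ N, ∃ n ≥ N, A (past π n) (π n)} := by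
  have : {π : ℕ → S | ∀ N, ∃ n ≥ N, A (past π n) (π n)} =
      ⋂ N, ⋃ n, ⋃ _ : n ≥ N, {π : ℕ → S | A (past π n) (π n)} := by
    ext π; simp
  rw [this]
  exact .iInter fun N => .iUnion fun n => .iUnion fun _ => measurableSet_history n A

/-- Any property of the set of recurrent states is measurable, as there are only finitely many such
sets. -/
theorem measurableSet_infSet (Q : Set S → Prop) : MeasurableSet {π : ℕ → S | Q (infSet π)} := by
  have h1 : ∀ D : Set S, MeasurableSet {π : ℕ → S | infSet π = D} := by
    intro D
    have : {π : ℕ → S | infSet π = D} = ⋂ x, {π : ℕ → S | x ∈ infSet π ↔ x ∈ D} := by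
      ext π
      simp [Set.ext_iff]
    rw [this]
    refine .iInter fun x => ?_
    by_cases hx : x ∈ D
    · simpa [hx, infSet] using measurableSet_frequently fun _ y => y = x
    · simpa [hx, infSet, Set.compl_def] using (measurableSet_frequently fun _ y => y = x).compl
  have : {π : ℕ → S | Q (infSet π)} = ⋃ D ∈ {D | Q D}, {π : ℕ → S | infSet π = D} := by
    ext π; simp
  rw [this]
  exact .biUnion (Set.to_countable _) fun D _ => h1 D

/-- If on every history in `A` the next state is `t` with probability at least `ε > 0`, then almost
surely `t` is visited infinitely often when `A` is. -/
theorem ae_frequently (M : FinMDP S) (σ : M.Strategy) (A : List S → S → Prop) (t : S) {ε : ℝ≥0∞}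
    (hε : ε ≠ 0) (hA : ∀ ρ s, A ρ s → ε ≤ M.next σ ρ s t) (s : S) :
    ∀ᵐ π ∂M.prob σ s, (∀ N, ∃ n ≥ N, A (past π n) (π n)) → t ∈ infSet π := by
  classical
  have hmN : ∀ (A : List S → S → Prop) N, MeasurableSet {π : ℕ → S |
      (∀ N, ∃ n ≥ N, A (past π n) (π n)) → ∃ n ≥ N, π (n + 1) = t} := by
    intro A N
    have : MeasurableSet {π : ℕ → S | ∃ n ≥ N, π (n + 1) = t} := by
      have : {π : ℕ → S | ∃ n ≥ N, π (n + 1) = t} =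
          ⋃ n, ⋃ _ : n ≥ N, {π : ℕ → S | π (n + 1) = t} := by ext; simp
      rw [this]
      exact .iUnion fun n => .iUnion fun _ => measurableSet_coord _ _
    convert! (measurableSet_frequently A).compl.union this using 1
    ext π
    simp only [Set.mem_ofPred_eq, Set.mem_union, Set.mem_compl_iff, imp_iff_not_or]
  suffices h : ∀ N, ∀ᵐ π ∂M.prob σ s, (∀ N, ∃ n ≥ N, A (past π n) (π n)) →
      ∃ n ≥ N, π (n + 1) = t by
    filter_upwards [ae_all_iff.2 h] with π hπ hf N
    obtain ⟨n, hn, ht⟩ := hπ N hf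
    exact ⟨n + 1, by omega, ht⟩
  intro N
  induction N generalizing σ A s with
  | zero =>
    rw [ae_iff]
    have hle : ∀ k : ℕ, M.prob σ s {π | ¬((∀ N, ∃ n ≥ N, A (past π n) (π n)) →
        ∃ n ≥ 0, π (n + 1) = t)} ≤ (1 - ε) ^ k := by
      intro k
      have hmono : Monotone fun N => {π : ℕ → S |
          k ≤ Nat.count (fun n => A (past π n) (π n)) N ∧ ∀ n, π (n + 1) ≠ t} := by
        intro N N' h π hπ
        exact ⟨hπ.1.trans (Nat.count_monotone _ h), hπ.2⟩
      have hsub : {π | ¬((∀ N, ∃ n ≥ N, A (past π n) (π n)) → ∃ n ≥ 0, π (n + 1) = t)} ⊆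
          ⋃ N, {π : ℕ → S |
          k ≤ Nat.count (fun n => A (past π n) (π n)) N ∧ ∀ n, π (n + 1) ≠ t} := by
        intro π hπ
        simp only [Set.mem_ofPred_eq, Classical.not_imp, not_exists, not_and] at hπ
        obtain ⟨hf, hn⟩ := hπ
        have hinf : (Set.ofPred fun n => A (past π n) (π n)).Infinite :=
          Nat.frequently_atTop_iff_infinite.1 (Filter.frequently_atTop.2 hf)
        refine Set.mem_iUnion.2 ⟨Nat.nth (fun n => A (past π n) (π n)) k, ?_,
          fun n => hn n (Nat.zero_le _)⟩
        rw [Nat.count_nth_of_infinite hinf]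
      refine (measure_mono hsub).trans ?_
      rw [hmono.measure_iUnion]
      refine iSup_le fun N => (measure_mono ?_).trans (prob_count_le M t ε N k σ A hA s)
      rintro π ⟨h1, h2⟩
      exact ⟨h1, fun n _ => h2 n⟩
    have hlim : Filter.Tendsto (fun k : ℕ => (1 - ε) ^ k) Filter.atTop (nhds 0) :=
      ENNReal.tendsto_pow_atTop_nhds_zero_of_lt_one
        (ENNReal.sub_lt_self ENNReal.one_ne_top one_ne_zero hε)
    exact le_antisymm (ge_of_tendsto' hlim hle) zero_le
  | succ N ih =>
    refine ae_of_shift M σ s (hmN A (N + 1)) fun u _ => ?_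
    filter_upwards [ih (σ.shift s) (fun ρ x => A (s :: ρ) x) (fun ρ x hx => hA _ _ hx) u]
      with π hπ hf
    obtain ⟨n, hn, ht⟩ := hπ fun N => by
      obtain ⟨n, hn, ha⟩ := hf (N + 1)
      obtain ⟨n, rfl⟩ : ∃ j, n = j + 1 := ⟨n - 1, by omega⟩
      exact ⟨n, by omega, by simpa using ha⟩
    exact ⟨n + 1, by omega, ht⟩

end Probability

/-! ### States that occur infinitely often -/

theorem exists_mem_infSet [Finite S] {π : ℕ → S} {U : Set S} (h : ∀ N, ∃ n ≥ N, π n ∈ U) :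
    ∃ x ∈ U, x ∈ infSet π := by
  by_contra! hc
  have h1 : ∀ x, ∀ᶠ n in Filter.atTop, x ∈ U → π n ≠ x := by
    intro x
    by_cases hx : x ∈ U
    · have := hc x hx
      simp only [infSet, Set.mem_ofPred_eq, not_forall, not_exists, not_and] at this
      obtain ⟨N, hN⟩ := this
      exact Filter.eventually_atTop.2 ⟨N, fun n hn _ => hN n hn⟩
    · exact Filter.Eventually.of_forall fun n h => absurd h hx
  obtain ⟨N, hN⟩ := Filter.eventually_atTop.1 (Filter.eventually_all.2 h1)
  obtain ⟨n, hn, hU⟩ := h N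
  exact hN n hn (π n) hU rfl

theorem infSet_nonempty [Finite S] (π : ℕ → S) : (infSet π).Nonempty := by
  obtain ⟨x, _, hx⟩ := exists_mem_infSet (π := π) (U := Set.univ) fun N => ⟨N, le_rfl, trivial⟩
  exact ⟨x, hx⟩

theorem eventually_mem_infSet [Finite S] (π : ℕ → S) : ∃ N, ∀ n ≥ N, π n ∈ infSet π := by
  by_contra! h
  obtain ⟨x, hx, hx'⟩ := exists_mem_infSet (π := π) (U := (infSet π)ᶜ) h
  exact hx hx'

theorem infSet_shift (π : ℕ → S) (k : ℕ) : infSet (fun n => π (k + n)) = infSet π := by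
  ext x
  constructor
  · intro h N
    obtain ⟨n, hn, hx⟩ := h N
    exact ⟨k + n, by omega, hx⟩
  · intro h N
    obtain ⟨n, hn, hx⟩ := h (k + N)
    exact ⟨n - k, by omega, by simpa [show k + (n - k) = n by omega] using hx⟩

/-- The parity objective is prefix independent. -/
theorem parity_shift (p : S → ℕ) (π : ℕ → S) (k : ℕ) :
    (fun n => π (k + n)) ∈ parity p ↔ π ∈ parity p := by
  simp only [parity, Set.mem_ofPred_eq, infSet_shift]

theorem mem_parity_of_maxEven [Finite S] {p : S → ℕ} {π : ℕ → S} {D : Set S} {x : S}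
    (hx : x ∈ infSet π) (hxD : x ∈ maxEven p D) (hD : infSet π ⊆ D) : π ∈ parity p := by
  obtain ⟨y, hy, hmax⟩ := Set.exists_max_image (infSet π) p (Set.toFinite _) ⟨x, hx⟩
  refine ⟨p y, ⟨⟨y, hy, rfl⟩, ?_⟩, ?_⟩
  · rintro _ ⟨z, hz, rfl⟩
    exact hmax z hz
  · by_contra hodd
    exact absurd (hmax x hx) (not_le.2 (hxD.2.2 y (hD hy) (Nat.not_even_iff_odd.1 hodd)))

theorem maxEven_infSet_nonempty {p : S → ℕ} {π : ℕ → S} (h : π ∈ parity p) :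
    (maxEven p (infSet π)).Nonempty := by
  obtain ⟨m, ⟨⟨x, hx, rfl⟩, hmax⟩, hev⟩ := h
  refine ⟨x, hx, hev, fun t ht hodd => lt_of_le_of_ne (hmax ⟨t, ht, rfl⟩) ?_⟩
  intro h
  rw [h] at hodd
  exact (Nat.not_even_iff_odd.2 hodd) hev

/-- A play that eventually follows the graph `R`, and whose set of recurrent states is closed under
`R`, has `D` as that set when `D` is closed under `R` and all its states are reachable. -/
theorem infSet_eq_of_closed [Finite S] {R : S → S → Prop} {π : ℕ → S} {D : Set S}
    (hstep : ∃ N, ∀ n ≥ N, R (π n) (π (n + 1)))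
    (hcl : ∀ x ∈ infSet π, ∀ y, R x y → y ∈ infSet π)
    (hD : ∀ x ∈ D, ∀ y, R x y → y ∈ D) (hne : D.Nonempty)
    (hreach : ∀ x, ∀ y ∈ D, Relation.ReflTransGen R x y) : infSet π = D := by
  have hsub : D ⊆ infSet π := by
    intro y hy
    obtain ⟨x, hx⟩ := infSet_nonempty π
    have h := hreach x y hy
    clear hy
    induction h with
    | refl => exact hx
    | tail _ h ih => exact hcl _ ih _ h
  refine Set.Subset.antisymm (fun x hx => ?_) hsub
  obtain ⟨N, hN⟩ := hstep
  obtain ⟨d, hd⟩ := hne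
  obtain ⟨n, hn, rfl⟩ := hsub hd N
  have hstay : ∀ k, π (n + k) ∈ D := by
    intro k
    induction k with
    | zero => exact hd
    | succ k ih => exact hD _ ih _ (hN _ (by omega))
  obtain ⟨m, hm, rfl⟩ := hx n
  simpa [show n + (m - n) = m by omega] using hstay (m - n)

theorem isEC_infSet [Finite S] (M : FinMDP S) {π : ℕ → S} (hπ : π ∈ M.plays)
    (h : ∀ s ∈ infSet π, s ∉ M.S₁ → ∀ t, M.E s t → t ∈ infSet π) : M.IsEC (infSet π) := by
  obtain ⟨N, hN⟩ := eventually_mem_infSet π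
  refine ⟨infSet_nonempty π, h, fun s hs _ => ?_, fun s hs t ht => ?_⟩
  · obtain ⟨n, hn, rfl⟩ := hs N
    exact ⟨π (n + 1), hN _ (by omega), hπ n⟩
  · obtain ⟨n, hn, rfl⟩ := hs N
    obtain ⟨m, hm, rfl⟩ := ht n
    induction m, hm using Nat.le_induction with
    | base => exact .refl
    | succ m hm ih =>
      exact (ih (hN m (by omega))).tail ⟨hN m (by omega), hN (m + 1) (by omega), hπ m⟩

/-! ### The uniform strategy of an end-component -/

open Classical in
/-- The memoryless strategy that moves uniformly among the successors in `D` from the states of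
`D`, and uniformly among all successors from the other states. The value in the second case of the
definition is irrelevant when `D` is an end-component. -/
noncomputable def uniformStrategy [Finite S] (N : FinMDP S) (D : Set S) : N.Strategy where
  act _ s :=
    if h : (Set.toFinite {t | N.E s t ∧ (s ∈ D → t ∈ D)}).toFinset.Nonempty then
      PMF.uniformOfFinset _ h
    else PMF.pure (N.nonblocking s).choose
  support_act _ s _ := by
    split
    · intro t ht
      rw [PMF.support_uniformOfFinset] at ht
      simp only [Set.Finite.coe_toFinset] at ht
      exact ht.1
    · intro t ht
      rw [PMF.support_pure, Set.mem_singleton_iff] at ht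
      rw [ht]
      exact (N.nonblocking s).choose_spec

theorem next_uniformStrategy_ne_zero_iff [Finite S] (N : FinMDP S) {D : Set S} (hD : N.IsEC D)
    (ρ : List S) (x y : S) :
    N.next (N.uniformStrategy D) ρ x y ≠ 0 ↔ N.E x y ∧ (x ∈ D → y ∈ D) := by
  unfold next
  split
  · next hx =>
    have h : (Set.toFinite {t | N.E x t ∧ (x ∈ D → t ∈ D)}).toFinset.Nonempty := by
      rw [Set.Finite.toFinset_nonempty]
      by_cases hxD : x ∈ D
      · obtain ⟨t, ht, hE⟩ := hD.player_stays x hxD hx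
        exact ⟨t, hE, fun _ => ht⟩
      · obtain ⟨t, ht⟩ := N.nonblocking x
        exact ⟨t, ht, fun h => absurd h hxD⟩
    have he : (N.uniformStrategy D).act ρ x = PMF.uniformOfFinset _ h := dif_pos h
    rw [he, ← PMF.mem_support_iff, PMF.support_uniformOfFinset]
    simp
  · next hx =>
    rw [← PMF.mem_support_iff, N.support_δ]
    exact ⟨fun h => ⟨h, fun hxD => hD.stochastic_closed x hxD hx y h⟩, fun h => h.1⟩

/-! ### Almost sure properties of the recurrent states -/

section Probability

variable [Finite S] [MeasurableSpace S] [MeasurableSingletonClass S]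

theorem almostSure_iff (M : FinMDP S) (σ : M.Strategy) (s : S) {P : (ℕ → S) → Prop}
    (hP : MeasurableSet {π | P π}) :
    M.AlmostSure σ s {π | P π} ↔ ∀ᵐ π ∂M.prob σ s, P π :=
  (mem_ae_iff_prob_eq_one hP).symm

theorem measurableSet_parity (p : S → ℕ) : MeasurableSet (parity p) :=
  measurableSet_infSet fun I => ∃ m, IsGreatest (p '' I) m ∧ Even m

theorem almostSure_parity_iff (M : FinMDP S) (σ : M.Strategy) (s : S) (p : S → ℕ) :
    M.AlmostSure σ s (parity p) ↔ ∀ᵐ π ∂M.prob σ s, π ∈ parity p :=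
  (mem_ae_iff_prob_eq_one (measurableSet_parity p)).symm

theorem measurableSet_reach (T : Set S) : MeasurableSet (reach T) := by
  have : reach T = ⋃ n, {π : ℕ → S | π n ∈ T} := by ext; simp [reach]
  rw [this]
  exact .iUnion fun n => measurableSet_history n fun _ x => x ∈ T

/-- Almost surely, the states that occur infinitely often form an end-component. -/
theorem ae_isEC_infSet (M : FinMDP S) (σ : M.Strategy) (s : S) :
    ∀ᵐ π ∂M.prob σ s, M.IsEC (infSet π) := by
  have h : ∀ x t, x ∉ M.S₁ → M.E x t → ∀ᵐ π ∂M.prob σ s, x ∈ infSet π → t ∈ infSet π := by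
    intro x t hx ht
    have hsupp : t ∈ (M.δ ⟨x, hx⟩).support := by rw [M.support_δ]; exact ht
    refine ae_frequently M σ (fun _ y => y = x) t ((PMF.mem_support_iff _ _).1 hsupp) ?_ s
    rintro ρ _ rfl
    simp [next, hx]
  have h' := ae_all_iff.2 fun x => ae_all_iff.2 fun t =>
    ae_all_iff.2 fun hx : x ∉ M.S₁ => ae_all_iff.2 fun ht : M.E x t => h x t hx ht
  filter_upwards [h', ae_mem_out M σ s] with π hπ hout
  exact isEC_infSet M hout.1 fun x hx hx1 t ht => hπ x t hx1 ht hx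

/-! ### Existence of witnesses and round lengths -/

theorem exists_isFirstWitness (N : FinMDP S) (p₁ : S → ℕ)
    (h : ∀ s, ∃ σ : N.Strategy, N.Sure σ s (parity p₁) ∧
      N.AlmostSure σ s (reach (maxEven p₁ Set.univ))) :
    ∃ σ, N.IsFirstWitness p₁ σ := by
  choose f hf using h
  -- The strategy reads the initial state off the history and follows the witness for it.
  let σ : N.Strategy := ⟨fun ρ u => (f (ρ.headD u)).act ρ u, fun ρ u hu => (f _).support_act ρ u hu⟩
  refine ⟨σ, fun s => ⟨fun π hπ => (hf s).1 ?_, ?_⟩⟩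
  · refine ⟨hπ.1, hπ.2.1, fun n hn => ?_⟩
    have h1 := hπ.2.2 n hn
    have h2 : (past π n).headD (π n) = s := by
      cases n with
      | zero => simpa using hπ.2.1
      | succ n => rw [past_cons_pred]; exact hπ.2.1
    change π (n + 1) ∈ ((f ((past π n).headD (π n))).act _ _).support at h1
    rwa [h2] at h1
  · have : N.prob σ s = N.prob (f s) s := prob_congr rfl fun ρ u => rfl
    unfold AlmostSure
    rw [this]
    exact (hf s).2

/-- Under a memoryless strategy, almost surely the recurrent states are closed under the edges of
the induced Markov chain. -/
theorem ae_infSet_closed (N : FinMDP S) {σ : N.Strategy} (hσ : σ.IsMemoryless) (s : S) :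
    ∀ᵐ π ∂N.prob σ s, ∀ x ∈ infSet π, ∀ y, N.next σ [] x y ≠ 0 → y ∈ infSet π := by
  have h : ∀ x y, N.next σ [] x y ≠ 0 →
      ∀ᵐ π ∂N.prob σ s, x ∈ infSet π → y ∈ infSet π := by
    intro x y hxy
    refine ae_frequently N σ (fun _ z => z = x) y hxy ?_ s
    rintro ρ _ rfl
    rw [hσ.next_eq ρ]
  filter_upwards [ae_all_iff.2 fun x => ae_all_iff.2 fun y =>
    ae_all_iff.2 fun hxy : N.next σ [] x y ≠ 0 => h x y hxy] with π hπ x hx y hxy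
  exact hπ x y hxy hx

theorem ae_infSet_uniformStrategy (N : FinMDP S)
    (hconn : ∀ s t, Relation.ReflTransGen N.E s t) {D : Set S} (hD : N.IsEC D) (s : S) :
    ∀ᵐ π ∂N.prob (N.uniformStrategy D) s, infSet π = D := by
  have hmem : (N.uniformStrategy D).IsMemoryless := fun ρ s => rfl
  filter_upwards [ae_infSet_closed N hmem s, ae_mem_out N _ s] with π hcl hout
  rw [mem_out_iff] at hout
  refine infSet_eq_of_closed (R := fun x y => N.next (N.uniformStrategy D) [] x y ≠ 0)
    ⟨0, fun n _ => by rw [← hmem.next_eq (past π n)]; exact hout.2 n⟩ hcl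
    (fun x hx y h => ((next_uniformStrategy_ne_zero_iff N hD _ x y).1 h).2 hx) hD.nonempty
    fun x y hy => ?_
  simp only [next_uniformStrategy_ne_zero_iff N hD]
  -- Along a path towards `y`, the part after the first state of `D` is replaced by a path in `D`.
  induction hconn x y using Relation.ReflTransGen.head_induction_on with
  | refl => exact .refl
  | @head a c hac _ ih =>
    by_cases ha : a ∈ D
    · exact (hD.connected a ha y hy).lift id fun u v huv => ⟨huv.2.2, fun _ => huv.2.1⟩
    · exact ih.head ⟨hac, fun h => absurd h ha⟩

theorem exists_isSecondWitness [Nonempty S] (N : FinMDP S) (p₁ p₂ : S → ℕ)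
    (hconn : ∀ s t, Relation.ReflTransGen N.E s t)
    (h : ∀ s, ∃ σ : N.Strategy, N.AlmostSure σ s (parity p₁) ∧ N.AlmostSure σ s (parity p₂)) :
    ∃ σ D, N.IsSecondWitness p₁ p₂ σ D := by
  obtain ⟨s₀⟩ := ‹Nonempty S›
  obtain ⟨σ, h1, h2⟩ := h s₀
  -- The set of recurrent states of a typical play serves as `D`.
  obtain ⟨π, hD, h1, h2⟩ := ((ae_isEC_infSet N σ s₀).and
    (((almostSure_parity_iff N σ s₀ p₁).1 h1).and
      ((almostSure_parity_iff N σ s₀ p₂).1 h2))).exists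
  have hinf := ae_infSet_uniformStrategy N hconn hD
  have hpar : ∀ p : S → ℕ, π ∈ parity p → ∀ s,
      N.AlmostSure (N.uniformStrategy (infSet π)) s (parity p) := by
    intro p hp s
    rw [almostSure_parity_iff]
    filter_upwards [hinf s] with ρ hρ
    simpa only [parity, Set.mem_ofPred_eq, hρ] using hp
  exact ⟨N.uniformStrategy (infSet π), infSet π, fun _ _ => rfl,
    fun s => ⟨hpar p₁ h1 s, hpar p₂ h2 s⟩, hD, maxEven_infSet_nonempty h1,
    maxEven_infSet_nonempty h2, fun s =>
      (almostSure_iff N _ s (measurableSet_infSet fun I => I = infSet π)).2 (hinf s)⟩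

theorem IsSecondWitness.ae_infSet_eq {N : FinMDP S} {p₁ p₂ : S → ℕ} {σ : N.Strategy} {D : Set S}
    (h : N.IsSecondWitness p₁ p₂ σ D) (s : S) : ∀ᵐ π ∂N.prob σ s, infSet π = D :=
  (almostSure_iff N σ s (measurableSet_infSet fun I => I = D)).1 (h.2.2.2.2.2 s)

/-- The chain of a second witness cannot leave `D`: the recurrent states of a typical play are
closed under its edges. -/
theorem IsSecondWitness.closed {N : FinMDP S} {p₁ p₂ : S → ℕ} {σ : N.Strategy} {D : Set S}
    (h : N.IsSecondWitness p₁ p₂ σ D) : ∀ x ∈ D, ∀ y, N.next σ [] x y ≠ 0 → y ∈ D := by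
  intro x hx y hxy
  obtain ⟨π, hπ, rfl⟩ := ((ae_infSet_closed N h.1 x).and (h.ae_infSet_eq x)).exists
  exact hπ x hx y hxy

theorem IsSecondWitness.reachable {N : FinMDP S} {p₁ p₂ : S → ℕ} {σ : N.Strategy} {D : Set S}
    (h : N.IsSecondWitness p₁ p₂ σ D) (x : S) : ∀ y ∈ D,
    Relation.ReflTransGen (fun a b => N.next σ [] a b ≠ 0) x y := by
  intro y hy
  obtain ⟨π, hπ, hinf⟩ := ((ae_mem_out N σ x).and (h.ae_infSet_eq x)).exists
  rw [mem_out_iff] at hπ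
  rw [← hinf] at hy
  obtain ⟨n, -, rfl⟩ := hy 0
  rw [← hπ.1]
  clear hy
  induction n with
  | zero => exact .refl
  | succ n ih => exact ih.tail (by rw [← h.1.next_eq (past π n)]; exact hπ.2 n)

theorem measurableSet_visit (T : Set S) (n : ℕ) :
    MeasurableSet {π : ℕ → S | ∃ j ≤ n, π j ∈ T} :=
  measurableSet_of_dependsOn (n + 1) fun π ρ h ⟨j, hj, hT⟩ =>
    ⟨j, hj, by rw [← h j (by omega)]; exact hT⟩

theorem exists_isRoundLengths (N : FinMDP S) (σ : N.Strategy) (T : Set S)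
    (h : ∀ s, ∀ᵐ π ∂N.prob σ s, π ∈ reach T) : ∃ n, N.IsRoundLengths σ T n := by
  have hmono : Monotone fun n => {π : ℕ → S | ∃ j ≤ n, π j ∈ T} := by
    rintro n m hnm π ⟨j, hj, hT⟩
    exact ⟨j, hj.trans hnm, hT⟩
  have key : ∀ (i : ℕ) s, ∃ n, 1 - (2⁻¹ : ℝ≥0∞) ^ i ≤ N.prob σ s {π | ∃ j ≤ n, π j ∈ T} := by
    intro i s
    have h1 : N.prob σ s (⋃ n, {π : ℕ → S | ∃ j ≤ n, π j ∈ T}) = 1 := by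
      have : (⋃ n, {π : ℕ → S | ∃ j ≤ n, π j ∈ T}) = reach T := by
        ext π
        simp only [Set.mem_iUnion, Set.mem_ofPred_eq, reach]
        exact ⟨fun ⟨_, j, _, hj⟩ => ⟨j, hj⟩, fun ⟨j, hj⟩ => ⟨j, j, le_rfl, hj⟩⟩
      rw [this]
      exact (mem_ae_iff_prob_eq_one (measurableSet_reach T)).1 (h s)
    have h2 : 1 - (2⁻¹ : ℝ≥0∞) ^ i < N.prob σ s (⋃ n, {π : ℕ → S | ∃ j ≤ n, π j ∈ T}) := by
      rw [h1]
      exact ENNReal.sub_lt_self ENNReal.one_ne_top one_ne_zero (by simp)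
    rw [hmono.measure_iUnion] at h2
    obtain ⟨n, hn⟩ := lt_iSup_iff.1 h2
    exact ⟨n, hn.le⟩
  choose f hf using key
  choose B hB using fun i => Finite.exists_le (f i)
  exact ⟨fun i => B i + 1, fun i _ => Nat.le_add_left 1 _, fun i s =>
    (hf i s).trans (measure_mono (hmono ((hB i s).trans (Nat.le_succ _))))⟩

end Probability

/-! ### The memory of the round-based strategy -/

namespace Phase

/-- The phase is of kind (b). -/
def IsB : Phase S → Prop
  | .a _ _ => False
  | .b _ _ => True

/-- A measure of progress: it never decreases during a play, and its parity tells the two kinds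
of phases apart. -/
def rank : Phase S → ℕ
  | .a i _ => 2 * i + 1
  | .b i _ => 2 * i

theorem isB_iff_even_rank (m : Phase S) : m.IsB ↔ Even m.rank := by
  cases m <;> simp [IsB, rank]

/-- The memory after a move from `s`, where `m` is the memory on arrival in `s`. -/
noncomputable def step (T U : Set S) (n : ℕ → ℕ) (m : Phase S) (s : S) : Phase S :=
  (m.settle T U n s).push s

/-- The phase in which the move at time `k` of the play `π` is made, for the initial memory `m`. -/
noncomputable def memory (T U : Set S) (n : ℕ → ℕ) (m : Phase S) (π : ℕ → S) (k : ℕ) : Phase S :=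
  ((past π k).foldl (step T U n) m).settle T U n (π k)

variable {T U : Set S} {n : ℕ → ℕ}

theorem memory_zero (m : Phase S) (π : ℕ → S) :
    memory T U n m π 0 = m.settle T U n (π 0) := by
  simp [memory]

theorem memory_succ (m : Phase S) (π : ℕ → S) (k : ℕ) :
    memory T U n m π (k + 1) = ((memory T U n m π k).push (π k)).settle T U n (π (k + 1)) := by
  simp [memory, past_succ, step]

theorem memory_cons_succ (m : Phase S) (s : S) (π : ℕ → S) (k : ℕ) :
    memory T U n m (cons s π) (k + 1) = memory T U n (step T U n m s) π k := by
  simp [memory]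

theorem notMem_of_isB_settle {m : Phase S} {s : S} (h : (m.settle T U n s).IsB) : s ∉ U := by
  intro hs
  cases m <;> simp only [settle] at h <;> split_ifs at h <;> simp_all [IsB]

theorem settle_a_of_isB {i : ℕ} {g : List S} {s : S}
    (h : ((Phase.a i g).settle T U n s).IsB) :
    (Phase.a i g).settle T U n s = .b (i + 1) [] := by
  simp only [settle] at h ⊢
  split_ifs at h ⊢ <;> simp_all [IsB]

theorem rank_le_rank_step (m : Phase S) (s t : S) :
    m.rank ≤ ((m.push s).settle T U n t).rank := by
  cases m <;> simp only [push, settle] <;> split_ifs <;> simp only [rank] <;> omega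

theorem monotone_rank_memory (m : Phase S) (π : ℕ → S) :
    Monotone fun k => (memory T U n m π k).rank :=
  monotone_nat_of_le_succ fun k => by
    rw [memory_succ]
    exact rank_le_rank_step _ _ _

/-- If from some time on there are only moves of phases (b), then they belong to a single phase
(b), which has a start. -/
theorem exists_start_of_eventually_isB {π : ℕ → S}
    (h : ∃ K, ∀ k ≥ K, (memory T U n (.a 0 []) π k).IsB) :
    ∃ K i, memory T U n (.a 0 []) π K = .b i [] ∧
      ∀ k ≥ K, (memory T U n (.a 0 []) π k).IsB := by
  classical
  have hK := Nat.find_spec h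
  rcases hn : Nat.find h with _ | k
  · rw [hn] at hK
    refine ⟨0, 1, ?_, hK⟩
    have h0 := hK 0 le_rfl
    rw [memory_zero] at h0 ⊢
    exact settle_a_of_isB h0
  · rw [hn] at hK
    have hlast : ¬(memory T U n (.a 0 []) π k).IsB := by
      intro hb
      have := Nat.find_min h (m := k) (by omega)
      refine this fun j hj => ?_
      rcases Nat.eq_or_lt_of_le hj with rfl | hj
      · exact hb
      · exact hK j hj
    have h1 := hK (k + 1) le_rfl
    rw [memory_succ] at h1
    rcases hm : memory T U n (.a 0 []) π k with ⟨i, g⟩ | ⟨i, g⟩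
    · refine ⟨k + 1, i + 1, ?_, hK⟩
      rw [memory_succ]
      rw [hm] at h1 ⊢
      exact settle_a_of_isB h1
    · rw [hm] at hlast
      exact absurd trivial hlast

/-- In a phase (b) that never ends, the memory is the history since the start of the phase. -/
theorem memory_of_forall_isB {m : Phase S} {π : ℕ → S} {K i : ℕ}
    (h0 : memory T U n m π K = .b i []) (h : ∀ k ≥ K, (memory T U n m π k).IsB) (k : ℕ) :
    memory T U n m π (K + k) = .b i (past (fun j => π (K + j)) k) := by
  induction k with
  | zero => simpa using h0
  | succ k ih =>
    have hU : π (K + k + 1) ∉ U := by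
      have := h (K + k + 1) (by omega)
      rw [memory_succ] at this
      exact notMem_of_isB_settle this
    rw [← add_assoc, memory_succ, ih, past_succ]
    simp [push, settle, hU]

/-- If phases (b) occur in boundedly many rounds only, and none of them lasts forever, then from
some time on there are only phases (a). -/
theorem eventually_not_isB {π : ℕ → S}
    (h1 : ∃ J, ∀ j ≥ J, ∀ k g, memory T U n (.a 0 []) π k ≠ .b j g)
    (h2 : ∀ K i, memory T U n (.a 0 []) π K = .b i [] →
      ∃ k ≥ K, ¬(memory T U n (.a 0 []) π k).IsB) :
    ∃ K, ∀ k ≥ K, ¬(memory T U n (.a 0 []) π k).IsB := by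
  by_contra! hio
  obtain ⟨J, hJ⟩ := h1
  -- The rank is bounded and monotone, hence eventually constant; its parity then excludes all
  -- phases (a) from some time on.
  set r := fun k => (memory T U n (.a 0 []) π k).rank with hr
  have hmono : Monotone r := monotone_rank_memory _ _
  have hbdd : BddAbove (Set.range r) := by
    refine ⟨2 * J, ?_⟩
    rintro _ ⟨k, rfl⟩
    obtain ⟨k', hk', hb⟩ := hio k
    refine (hmono hk').trans ?_
    rcases hm : memory T U n (.a 0 []) π k' with ⟨i, g⟩ | ⟨i, g⟩
    · rw [hm] at hb; exact hb.elim
    · have : i < J := by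
        by_contra hi
        exact hJ i (not_lt.1 hi) k' g hm
      simp only [hr, hm, rank]
      omega
  obtain ⟨K, hK⟩ := Nat.sSup_mem (Set.range_nonempty r) hbdd
  have hconst : ∀ k ≥ K, r k = r K := fun k hk =>
    le_antisymm (hK ▸ le_csSup hbdd ⟨k, rfl⟩) (hmono hk)
  obtain ⟨k₀, hk₀, hb₀⟩ := hio K
  have hall : ∀ k ≥ K, (memory T U n (.a 0 []) π k).IsB := by
    intro k hk
    rw [isB_iff_even_rank] at hb₀ ⊢
    change Even (r k)
    rw [hconst k hk, ← hconst k₀ hk₀]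
    exact hb₀
  obtain ⟨K', i, hK', hb⟩ := exists_start_of_eventually_isB ⟨K, hall⟩
  obtain ⟨k, hk, hk'⟩ := h2 K' i hK'
  exact hk' (hb k hk)

/-- While only phases (a) occur and `U` is avoided, every phase ends, and each of them visits `T`
at one of its states. -/
theorem exists_phase_end {m : Phase S} {π : ℕ → S} {N : ℕ}
    (ha : ∀ k ≥ N, ¬(memory T U n m π k).IsB) (hU : ∀ k ≥ N, π k ∉ U) (d : ℕ) :
    ∀ k ≥ N, ∀ i g, memory T U n m π k = .a i g → n i - g.length ≤ d →
    ∃ k' > k, ∃ i', memory T U n m π k' = .a i' [] ∧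
      ((∃ x ∈ g, x ∈ T) ∨ ∃ j ≥ k, π j ∈ T) := by
  have hend : ∀ k ≥ N, ∀ i g, memory T U n m π k = .a i g → ¬(g ++ [π k]).length < n i →
      ∃ k' > k, ∃ i', memory T U n m π k' = .a i' [] ∧
        ((∃ x ∈ g, x ∈ T) ∨ ∃ j ≥ k, π j ∈ T) := by
    intro k hk i g hm hlen
    have hnext := memory_succ (T := T) (U := U) (n := n) m π k
    have hb := ha (k + 1) (by omega)
    have hU' : π (k + 1) ∉ U := hU (k + 1) (by omega)
    rw [hnext, hm] at hb
    rw [hm] at hnext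
    simp only [push, settle, if_neg hlen] at hb hnext
    split_ifs at hb hnext with hT
    · refine ⟨k + 1, by omega, i + 1, hnext, ?_⟩
      obtain ⟨x, hx, hxT⟩ := hT.resolve_right hU'
      simp only [List.mem_append, List.mem_singleton] at hx
      rcases hx with (hx | rfl) | rfl
      · exact .inl ⟨x, hx, hxT⟩
      · exact .inr ⟨k, le_rfl, hxT⟩
      · exact .inr ⟨k + 1, by omega, hxT⟩
    · exact absurd trivial hb
  induction d with
  | zero =>
    intro k hk i g hm hd
    exact hend k hk i g hm (by simp; omega)
  | succ d ih =>
    intro k hk i g hm hd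
    by_cases hlen : (g ++ [π k]).length < n i
    · have hnext : memory T U n m π (k + 1) = .a i (g ++ [π k]) := by
        rw [memory_succ, hm]
        simp only [push, settle, if_pos hlen]
      obtain ⟨k', hk', i', h1, h2⟩ := ih (k + 1) (by omega) i _ hnext (by simp; omega)
      refine ⟨k', by omega, i', h1, ?_⟩
      rcases h2 with ⟨x, hx, hxT⟩ | ⟨j, hj, hjT⟩
      · simp only [List.mem_append, List.mem_singleton] at hx
        rcases hx with hx | rfl
        · exact .inl ⟨x, hx, hxT⟩
        · exact .inr ⟨k, le_rfl, hxT⟩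
      · exact .inr ⟨j, by omega, hjT⟩
    · exact hend k hk i g hm hlen

theorem frequently_mem_of_not_isB {m : Phase S} {π : ℕ → S} {N : ℕ}
    (ha : ∀ k ≥ N, ¬(memory T U n m π k).IsB) (hU : ∀ k ≥ N, π k ∉ U) (K : ℕ) :
    ∃ j ≥ K, π j ∈ T := by
  have hA : ∀ k ≥ N, ∃ i g, memory T U n m π k = .a i g := by
    intro k hk
    rcases hm : memory T U n m π k with ⟨i, g⟩ | ⟨i, g⟩
    · exact ⟨i, g, rfl⟩
    · exact absurd (by rw [hm]; trivial) (ha k hk)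
  obtain ⟨i, g, hm⟩ := hA (max K N) (le_max_right _ _)
  -- The phase that is under way at time `max K N` may have visited `T` earlier; the next one
  -- starts after that time.
  obtain ⟨k, hk, i', hm', -⟩ :=
    exists_phase_end ha hU _ _ (le_max_right _ _) i g hm le_rfl
  obtain ⟨-, -, -, -, h⟩ :=
    exists_phase_end ha hU _ k ((le_max_right K N).trans hk.le) i' [] hm' le_rfl
  rcases h with ⟨x, hx, -⟩ | ⟨j, hj, hT⟩
  · simp at hx
  · exact ⟨j, ((le_max_left K N).trans hk.le).trans hj, hT⟩

end Phase

open Phase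

/-! ### The round-based strategy from an arbitrary memory -/

/-- The round-based strategy with initial memory `m`. -/
noncomputable def Strategy.roundsFrom {N : FinMDP S} (σ₁ σ₂ : N.Strategy) (T U : Set S)
    (n : ℕ → ℕ) (m : Phase S) : N.Strategy where
  act ρ s :=
    match (ρ.foldl (Phase.step T U n) m).settle T U n s with
    | .a _ g => σ₂.act g s
    | .b _ g => σ₁.act g s
  support_act ρ s hs := by
    split
    · exact σ₂.support_act _ s hs
    · exact σ₁.support_act _ s hs

/-- The distribution of the next state when a move is made in the given phase. -/
noncomputable def phaseNext {N : FinMDP S} (σ₁ σ₂ : N.Strategy) (m : Phase S) (s : S) : PMF S :=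
  match m with
  | .a _ g => N.next σ₂ g s
  | .b _ g => N.next σ₁ g s

section

variable {N : FinMDP S} {σ₁ σ₂ : N.Strategy} {T U : Set S} {n : ℕ → ℕ}

theorem rounds_eq_roundsFrom : σ₁.rounds σ₂ T U n = σ₁.roundsFrom σ₂ T U n (.a 0 []) := rfl

theorem shift_roundsFrom (m : Phase S) (s : S) :
    (σ₁.roundsFrom σ₂ T U n m).shift s = σ₁.roundsFrom σ₂ T U n (m.step T U n s) := rfl

theorem next_roundsFrom (m : Phase S) (ρ : List S) (s : S) :
    N.next (σ₁.roundsFrom σ₂ T U n m) ρ s =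
      phaseNext σ₁ σ₂ ((ρ.foldl (Phase.step T U n) m).settle T U n s) s := by
  unfold next phaseNext
  by_cases h : s ∈ N.S₁
  · simp only [dif_pos h, Strategy.roundsFrom]
    split <;> simp [next, h]
  · simp only [dif_neg h]
    split <;> simp [next, h]

theorem mem_out_roundsFrom_iff (m : Phase S) (s : S) (π : ℕ → S) :
    π ∈ N.out (σ₁.roundsFrom σ₂ T U n m) s ↔
      π 0 = s ∧ ∀ k, phaseNext σ₁ σ₂ (memory T U n m π k) (π k) (π (k + 1)) ≠ 0 := by
  simp only [mem_out_iff, next_roundsFrom, memory]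

theorem phaseNext_of_not_isB (h : σ₂.IsMemoryless) {m : Phase S} (hm : ¬m.IsB) (s : S) :
    phaseNext σ₁ σ₂ m s = N.next σ₂ [] s := by
  rcases m with ⟨i, g⟩ | ⟨i, g⟩
  · exact h.next_eq g s
  · exact absurd trivial hm

end

/-! ### Sure satisfaction of the first objective -/

theorem sure_rounds [Finite S] [MeasurableSpace S] [MeasurableSingletonClass S] {N : FinMDP S}
    {p₁ p₂ : S → ℕ} {σ₁ σ₂ : N.Strategy}
    {D : Set S} (n : ℕ → ℕ) (h₁ : ∀ s, N.Sure σ₁ s (parity p₁))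
    (h₂ : N.IsSecondWitness p₁ p₂ σ₂ D) (s : S) :
    N.Sure (σ₁.rounds σ₂ (maxEven p₁ D) (maxEven p₁ Set.univ) n) s (parity p₁) := by
  intro π hπ
  rw [rounds_eq_roundsFrom, mem_out_roundsFrom_iff] at hπ
  replace hπ := hπ.2
  by_cases hU : ∀ N, ∃ k ≥ N, π k ∈ maxEven p₁ Set.univ
  · obtain ⟨x, hx, hinf⟩ := exists_mem_infSet hU
    exact mem_parity_of_maxEven hinf hx (Set.subset_univ _)
  push Not at hU
  obtain ⟨K, hK⟩ := hU
  by_cases hb : ∃ k ≥ K, (memory (maxEven p₁ D) (maxEven p₁ Set.univ) n (.a 0 []) π k).IsB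
  · -- A phase (b) that is under way after the last visit to the maximal even states never ends.
    obtain ⟨k, hk, hkb⟩ := hb
    have hall : ∀ j ≥ k, (memory (maxEven p₁ D) (maxEven p₁ Set.univ) n (.a 0 []) π j).IsB := by
      intro j hj
      induction j, hj using Nat.le_induction with
      | base => exact hkb
      | succ j hj ih =>
        rw [memory_succ]
        rcases hm : memory (maxEven p₁ D) (maxEven p₁ Set.univ) n (.a 0 []) π j
          with ⟨i, g⟩ | ⟨i, g⟩
        · rw [hm] at ih; exact ih.elim
        · simp [push, settle, hK (j + 1) (by omega), IsB]
    obtain ⟨K', i, hK', hb'⟩ := exists_start_of_eventually_isB ⟨k, hall⟩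
    rw [← parity_shift p₁ π K']
    refine h₁ (π K') ?_
    rw [mem_out_iff]
    refine ⟨rfl, fun j => ?_⟩
    have := hπ (K' + j)
    rw [memory_of_forall_isB hK' hb' j] at this
    exact this
  · push Not at hb
    have hT := frequently_mem_of_not_isB hb hK
    obtain ⟨x, hx, hinf⟩ := exists_mem_infSet hT
    refine mem_parity_of_maxEven hinf hx fun y hy => ?_
    -- From its first visit after time `K` on, the play stays in `D`.
    obtain ⟨k, hk, hkT⟩ := hT K
    have hstay : ∀ j, π (k + j) ∈ D := by
      intro j
      induction j with
      | zero => exact hkT.1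
      | succ j ih =>
        refine h₂.closed _ ih _ ?_
        rw [← phaseNext_of_not_isB h₂.1 (hb (k + j) (by omega))]
        exact hπ (k + j)
    obtain ⟨j, hj, rfl⟩ := hy k
    simpa [show k + (j - k) = j by omega] using hstay (j - k)
section Probability

variable [Finite S] [MeasurableSpace S] [MeasurableSingletonClass S]

theorem ae_zero_eq (M : FinMDP S) (σ : M.Strategy) (s : S) : ∀ᵐ π ∂M.prob σ s, π 0 = s := by
  filter_upwards [ae_mem_out M σ s] with π hπ using hπ.2.1

theorem measurableSet_memory (T U : Set S) (n : ℕ → ℕ) (m : Phase S) (k : ℕ)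
    (Q : Phase S → Prop) : MeasurableSet {π : ℕ → S | Q (memory T U n m π k)} :=
  measurableSet_history k fun ρ s => Q ((ρ.foldl (Phase.step T U n) m).settle T U n s)

/-! ### Phases (b) become rare -/

/-- The probability that `σ` avoids `T` up to time `k`. -/
noncomputable def missProb (N : FinMDP S) (σ : N.Strategy) (T : Set S) (k : ℕ) (s : S) : ℝ≥0∞ :=
  N.prob σ s {π | ∀ j ≤ k, π j ∉ T}

theorem measurableSet_miss (T : Set S) (k : ℕ) : MeasurableSet {π : ℕ → S | ∀ j ≤ k, π j ∉ T} := by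
  convert! (measurableSet_visit T k).compl using 1
  ext π
  simp

theorem missProb_zero (N : FinMDP S) (σ : N.Strategy) {T : Set S} {s : S} (hs : s ∉ T) :
    missProb N σ T 0 s = 1 := by
  refine (mem_ae_iff_prob_eq_one (measurableSet_miss T 0)).1 ?_
  filter_upwards [ae_zero_eq N σ s] with π hπ j hj
  obtain rfl : j = 0 := by omega
  rwa [hπ]

theorem missProb_succ (N : FinMDP S) (σ : N.Strategy) {T : Set S} {s : S} (hs : s ∉ T) (k : ℕ) :
    missProb N σ T (k + 1) s = ∑' t, N.next σ [] s t * missProb N (σ.shift s) T k t := by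
  rw [missProb, prob_apply N σ s (measurableSet_miss T (k + 1))]
  refine tsum_congr fun t => ?_
  rw [missProb]
  congr 2
  ext π
  constructor
  · intro h j hj
    exact h (j + 1) (by omega)
  · rintro h (_ | j) hj
    · exact hs
    · exact h j (by omega)

theorem IsRoundLengths.missProb_le {N : FinMDP S} {σ : N.Strategy} {T : Set S} {n : ℕ → ℕ}
    (h : N.IsRoundLengths σ T n) (i : ℕ) (s : S) : missProb N σ T (n i) s ≤ 2⁻¹ ^ i := by
  have hc : {π : ℕ → S | ∀ j ≤ n i, π j ∉ T} = {π : ℕ → S | ∃ j ≤ n i, π j ∈ T}ᶜ := by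
    ext π
    simp
  rw [missProb, hc, prob_compl_eq_one_sub (measurableSet_visit T (n i))]
  exact tsub_le_iff_tsub_le.1 (h.2 i s)

open Classical in
/-- An upper bound for the probability that a phase (b) of round `j + 1` is entered, given that a
move of the given phase is about to be made in the given state. In phase (a) of round `j` it is the
probability that the rest of the phase misses `T`, or `0` if `T` has been visited already; in all
earlier phases it is `2⁻ʲ`, in phase (b) of round `j + 1` it is `1`, and in all later ones `0`. -/
noncomputable def potential (N : FinMDP S) (σ₂ : N.Strategy) (T : Set S) (n : ℕ → ℕ) (j : ℕ) :
    Phase S → S → ℝ≥0∞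
  | .a i g, s =>
      if i < j then 2⁻¹ ^ j
      else if i = j then
        if ∃ x ∈ g, x ∈ T then 0 else missProb N σ₂ T (n j - g.length) s
      else 0
  | .b i _, _ => if i ≤ j then 2⁻¹ ^ j else if i = j + 1 then 1 else 0

variable {N : FinMDP S} {σ₁ σ₂ : N.Strategy} {T U : Set S} {n : ℕ → ℕ}

theorem potential_le_of_lt (h : N.IsRoundLengths σ₂ T n) {j i : ℕ} (hi : i < j) (t : S) :
    potential N σ₂ T n j (.a (i + 1) []) t ≤ 2⁻¹ ^ j := by
  rcases Nat.lt_or_ge (i + 1) j with hlt | hge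
  · simp [potential, hlt]
  · obtain rfl : j = i + 1 := by omega
    simpa [potential] using h.missProb_le (i + 1) t

theorem potential_le_one (j : ℕ) (m : Phase S) (s : S) : potential N σ₂ T n j m s ≤ 1 := by
  have h2 : (2⁻¹ : ℝ≥0∞) ^ j ≤ 1 := pow_le_one₀ zero_le (by simp)
  cases m <;> simp only [potential] <;> split_ifs <;> simp [h2, missProb, prob_le_one]

/-- The potential does not increase in expectation. -/
theorem tsum_potential_le (h : N.IsRoundLengths σ₂ T n) (hσ : σ₂.IsMemoryless) {j : ℕ} (hj : 1 ≤ j)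
    (m : Phase S) (s : S) (hm : ∀ g, m = .a j g → g.length < n j) :
    ∑' t, phaseNext σ₁ σ₂ m s t * potential N σ₂ T n j ((m.push s).settle T U n t) t ≤
      potential N σ₂ T n j m s := by
  rcases m with ⟨i, g⟩ | ⟨i, g⟩
  · rcases lt_trichotomy i j with hij | rfl | hij
    · have : potential N σ₂ T n j (.a i g) s = 2⁻¹ ^ j := by simp [potential, hij]
      rw [this]
      refine PMF.tsum_mul_le _ _ _ fun t _ => ?_
      simp only [push, settle]
      split_ifs
      · simp [potential, hij]
      · exact potential_le_of_lt h hij t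
      · simp [potential, Nat.succ_le_of_lt hij]
    · by_cases hT : ∃ x ∈ g ++ [s], x ∈ T
      · refine le_of_eq_of_le ?_ zero_le
        refine ENNReal.tsum_eq_zero.2 fun t => ?_
        have hT' : ∃ x ∈ (g ++ [s]) ++ [t], x ∈ T := by
          obtain ⟨x, hx, hxT⟩ := hT
          exact ⟨x, List.mem_append_left _ hx, hxT⟩
        simp only [push, settle]
        split_ifs
        · simp only [potential, lt_irrefl, if_false, if_true, if_pos hT, mul_zero]
        · simp [potential]
        · next hno => exact absurd (.inl hT') hno
      · have hg : ¬∃ x ∈ g, x ∈ T := fun ⟨x, hx, hxT⟩ =>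
          hT ⟨x, List.mem_append_left _ hx, hxT⟩
        have hs : s ∉ T := fun hs => hT ⟨s, by simp, hs⟩
        have hlen := hm g rfl
        obtain ⟨k, hk⟩ : ∃ k, n i - g.length = k + 1 := ⟨n i - g.length - 1, by omega⟩
        have : potential N σ₂ T n i (.a i g) s = missProb N σ₂ T (k + 1) s := by
          simp only [potential, lt_irrefl, if_false, if_true, if_neg hg, hk]
        rw [this, missProb_succ N σ₂ hs, hσ.shift_eq]
        refine ENNReal.tsum_le_tsum fun t => ?_
        rw [show phaseNext σ₁ σ₂ (.a i g) s = N.next σ₂ [] s from hσ.next_eq g s]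
        gcongr
        simp only [push, settle]
        split_ifs with h1 h2
        · simp only [potential, lt_irrefl, if_false, if_true, if_neg hT]
          rw [show n i - (g ++ [s]).length = k by simp; omega]
        · simp [potential]
        · obtain rfl : k = 0 := by simp at h1; omega
          rw [missProb_zero N σ₂ (fun ht => h2 (.inl ⟨t, by simp, ht⟩))]
          exact potential_le_one _ _ _
    · refine le_of_eq_of_le ?_ zero_le
      refine ENNReal.tsum_eq_zero.2 fun t => ?_
      simp only [push, settle]
      split_ifs <;> simp only [potential] <;> split_ifs <;> first | omega | simp
  · rcases Nat.lt_or_ge j i with hij | hij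
    · rcases Nat.lt_or_ge (j + 1) i with hij' | hij'
      · refine le_of_eq_of_le ?_ zero_le
        refine ENNReal.tsum_eq_zero.2 fun t => ?_
        simp only [push, settle]
        split_ifs <;> simp only [potential] <;> split_ifs <;> first | omega | simp
      · obtain rfl : i = j + 1 := by omega
        have : potential N σ₂ T n j (.b (j + 1) g) s = 1 := by simp [potential]
        rw [this]
        exact PMF.tsum_mul_le _ _ _ fun t _ => potential_le_one _ _ _
    · have : potential N σ₂ T n j (.b i g) s = 2⁻¹ ^ j := by simp [potential, hij]
      rw [this]
      refine PMF.tsum_mul_le _ _ _ fun t _ => ?_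
      simp only [push, settle]
      split_ifs
      · rcases Nat.eq_zero_or_pos i with rfl | hi
        · simp [potential, Nat.pos_of_ne_zero (by omega : j ≠ 0)]
        · obtain ⟨i, rfl⟩ : ∃ i', i = i' + 1 := ⟨i - 1, by omega⟩
          exact potential_le_of_lt h hij t
      · simp [potential, hij]

/-- After settling, a phase (a) of a round `j ≥ 1` has moves left, as such a round has positive
length. This may fail for the initial round. -/
theorem length_lt_of_settle_eq (h : N.IsRoundLengths σ₂ T n) {j : ℕ} (hj : 1 ≤ j) {m : Phase S}
    {s : S} {g : List S} (hm : m.settle T U n s = .a j g) : g.length < n j := by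
  rcases m with ⟨i, g'⟩ | ⟨i, g'⟩ <;> simp only [settle] at hm <;> split_ifs at hm with h1
  · cases hm; exact h1
  · cases hm; exact h.1 _ hj
  · cases hm; exact h.1 _ hj

/-- The maximal inequality for the superharmonic function `potential`, by induction on the time
horizon `K`. -/
theorem prob_exists_b_le_potential (h : N.IsRoundLengths σ₂ T n) (hσ : σ₂.IsMemoryless) {j : ℕ}
    (hj : 1 ≤ j) (K : ℕ) : ∀ (m : Phase S) (s : S),
    N.prob (σ₁.roundsFrom σ₂ T U n m) s {π | ∃ k ≤ K, ∃ g, memory T U n m π k = .b (j + 1) g} ≤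
      potential N σ₂ T n j (m.settle T U n s) s := by
  induction K with
  | zero =>
    intro m s
    by_cases hb : ∃ g, m.settle T U n s = .b (j + 1) g
    · obtain ⟨g, hg⟩ := hb
      rw [hg]
      refine prob_le_one.trans_eq ?_
      simp [potential]
    · refine le_of_eq_of_le (measure_mono_null ?_ (ae_iff.1 (ae_zero_eq N _ s))) zero_le
      rintro π ⟨k, hk, g, hg⟩ h0
      obtain rfl : k = 0 := by omega
      rw [memory_zero, h0] at hg
      exact hb ⟨g, hg⟩
  | succ K ih =>
    intro m s
    by_cases hb : ∃ g, m.settle T U n s = .b (j + 1) g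
    · obtain ⟨g, hg⟩ := hb
      rw [hg]
      refine prob_le_one.trans_eq ?_
      simp [potential]
    · have hmeas : MeasurableSet {π : ℕ → S | ∃ k ≤ K + 1, ∃ g,
          memory T U n m π k = .b (j + 1) g} := by
        have : {π : ℕ → S | ∃ k ≤ K + 1, ∃ g, memory T U n m π k = .b (j + 1) g} =
            ⋃ k, ⋃ _ : k ≤ K + 1, {π : ℕ → S | ∃ g, memory T U n m π k = .b (j + 1) g} := by
          ext; simp
        rw [this]
        exact .iUnion fun k => .iUnion fun _ =>
          measurableSet_memory T U n m k fun x => ∃ g, x = .b (j + 1) g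
      rw [prob_apply N _ s hmeas]
      refine le_trans (ENNReal.tsum_le_tsum fun t => ?_)
        (tsum_potential_le (U := U) (σ₁ := σ₁) h hσ hj (m.settle T U n s) s
          fun g hg => length_lt_of_settle_eq h hj hg)
      rw [next_roundsFrom, shift_roundsFrom]
      refine mul_le_mul' le_rfl (le_trans (measure_mono ?_) (ih (m.step T U n s) t))
      rintro π ⟨k, hk, g, hg⟩
      rcases k with _ | k
      · rw [memory_zero] at hg
        exact absurd ⟨g, hg⟩ hb
      · rw [memory_cons_succ] at hg
        exact ⟨k, by omega, g, hg⟩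

theorem prob_exists_b_le (h : N.IsRoundLengths σ₂ T n) (hσ : σ₂.IsMemoryless) {j : ℕ}
    (hj : 1 ≤ j) (s : S) :
    N.prob (σ₁.rounds σ₂ T U n) s {π | ∃ k g, memory T U n (.a 0 []) π k = .b (j + 1) g} ≤
      2⁻¹ ^ j := by
  have hmono : Monotone fun K => {π : ℕ → S | ∃ k ≤ K, ∃ g,
      memory T U n (.a 0 []) π k = .b (j + 1) g} := by
    rintro K K' hK π ⟨k, hk, hg⟩
    exact ⟨k, hk.trans hK, hg⟩
  have : {π : ℕ → S | ∃ k g, memory T U n (.a 0 []) π k = .b (j + 1) g} =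
      ⋃ K, {π : ℕ → S | ∃ k ≤ K, ∃ g, memory T U n (.a 0 []) π k = .b (j + 1) g} := by
    ext π
    simp only [Set.mem_iUnion, Set.mem_ofPred_eq]
    exact ⟨fun ⟨k, hg⟩ => ⟨k, k, le_rfl, hg⟩, fun ⟨_, k, _, hg⟩ => ⟨k, hg⟩⟩
  rw [this, hmono.measure_iUnion, rounds_eq_roundsFrom]
  refine iSup_le fun K => (prob_exists_b_le_potential h hσ hj K _ s).trans ?_
  simp only [settle]
  split_ifs
  · simp [potential, Nat.pos_of_ne_zero (by omega : j ≠ 0)]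
  · exact potential_le_of_lt h (by omega) s
  · simp [potential, hj]

theorem ae_eventually_ne_b (h : N.IsRoundLengths σ₂ T n) (hσ : σ₂.IsMemoryless) (s : S) :
    ∀ᵐ π ∂N.prob (σ₁.rounds σ₂ T U n) s,
      ∃ J, ∀ j ≥ J, ∀ k g, memory T U n (.a 0 []) π k ≠ .b j g := by
  have hsum : ∑' j : ℕ, N.prob (σ₁.rounds σ₂ T U n) s
      {π | ∃ k g, memory T U n (.a 0 []) π k = .b (j + 1 + 1) g} ≠ ⊤ := by
    refine ne_top_of_le_ne_top ?_ (ENNReal.tsum_le_tsum fun j : ℕ =>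
      prob_exists_b_le h hσ (Nat.le_add_left 1 j) s)
    simp [pow_succ, ENNReal.tsum_mul_right, ENNReal.tsum_geometric]
  filter_upwards [ae_eventually_notMem hsum] with π hπ
  obtain ⟨J, hJ⟩ := Filter.eventually_atTop.1 hπ
  refine ⟨J + 2, fun j hj k g hg => hJ (j - 2) (by omega) ⟨k, g, ?_⟩⟩
  rw [hg]
  congr 1
  omega

/-! ### Phases (b) end -/

/-- The strategy `σ` after the history `g`. -/
noncomputable def Strategy.shiftList {N : FinMDP S} (σ : N.Strategy) (g : List S) :
    N.Strategy where
  act ρ u := σ.act (g ++ ρ) u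
  support_act ρ u hu := σ.support_act (g ++ ρ) u hu

/-- A phase (b) in which `g` has been recorded lasts as long as `σ₁`, continued after the history
`g`, avoids `U`. -/
theorem prob_stay_b_le (K : ℕ) : ∀ (m : Phase S) (s : S) (i : ℕ) (g : List S),
    m.settle T U n s = .b i g →
    N.prob (σ₁.roundsFrom σ₂ T U n m) s {π | ∀ k ≤ K, (memory T U n m π k).IsB} ≤
      missProb N (σ₁.shiftList g) U K s := by
  induction K with
  | zero =>
    intro m s i g hm
    rw [missProb_zero N _ (notMem_of_isB_settle (T := T) (n := n) (m := m) (by rw [hm]; trivial))]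
    exact prob_le_one
  | succ K ih =>
    intro m s i g hm
    have hs : s ∉ U := notMem_of_isB_settle (T := T) (n := n) (m := m) (by rw [hm]; trivial)
    have hmeas : MeasurableSet {π : ℕ → S | ∀ k ≤ K + 1, (memory T U n m π k).IsB} := by
      have : {π : ℕ → S | ∀ k ≤ K + 1, (memory T U n m π k).IsB} =
          ⋂ k, ⋂ _ : k ≤ K + 1, {π : ℕ → S | (memory T U n m π k).IsB} := by
        ext; simp
      rw [this]
      exact .iInter fun k => .iInter fun _ => measurableSet_memory T U n m k IsB
    rw [prob_apply N _ s hmeas, missProb_succ N _ hs]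
    refine ENNReal.tsum_le_tsum fun t => ?_
    have hshift : (σ₁.shiftList g).shift s = σ₁.shiftList (g ++ [s]) := by
      simp [Strategy.shift, Strategy.shiftList]
    have hnext : N.next (σ₁.shiftList g) [] s = N.next σ₁ g s := by
      simp [next, Strategy.shiftList]
    have hstep : m.step T U n s = .b i (g ++ [s]) := by rw [Phase.step, hm]; rfl
    have hsub : cons s ⁻¹' {π : ℕ → S | ∀ k ≤ K + 1, (memory T U n m π k).IsB} ⊆
        {π | ∀ k ≤ K, (memory T U n (m.step T U n s) π k).IsB} := by
      intro π hπ k hk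
      have := hπ (k + 1) (by omega)
      rwa [memory_cons_succ] at this
    rw [next_roundsFrom, shift_roundsFrom, hshift, hnext]
    simp only [List.foldl_nil, hm, phaseNext]
    refine mul_le_mul' le_rfl ((measure_mono hsub).trans ?_)
    by_cases ht : t ∈ U
    · refine le_of_eq_of_le (measure_mono_null ?_ (ae_iff.1 (ae_zero_eq N _ t))) zero_le
      intro π hπ h0
      have := hπ 0 (Nat.zero_le _)
      rw [memory_zero, h0] at this
      exact notMem_of_isB_settle this ht
    · exact ih _ t i (g ++ [s]) (by rw [hstep]; simp [settle, ht])

theorem prob_forall_isB_eq_zero (h : ∀ s, N.AlmostSure σ₁ s (reach U)) (m : Phase S) (s : S)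
    (i : ℕ) (hm : m.settle T U n s = .b i []) :
    N.prob (σ₁.roundsFrom σ₂ T U n m) s {π | ∀ k, (memory T U n m π k).IsB} = 0 := by
  have hle : ∀ K, N.prob (σ₁.roundsFrom σ₂ T U n m) s {π | ∀ k, (memory T U n m π k).IsB} ≤
      missProb N σ₁ U K s := fun K =>
    (measure_mono (Set.ofPred_subset_ofPred.2 fun _ hπ k _ => hπ k)).trans
      (prob_stay_b_le K m s i [] hm)
  have hanti : Antitone fun K => {π : ℕ → S | ∀ j ≤ K, π j ∉ U} :=
    fun K K' hK π hπ j hj => hπ j (hj.trans hK)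
  have hlim := tendsto_measure_iInter_atTop (μ := N.prob σ₁ s)
    (fun K => (measurableSet_miss U K).nullMeasurableSet) hanti ⟨0, measure_ne_top _ _⟩
  have hzero : N.prob σ₁ s (⋂ K, {π : ℕ → S | ∀ j ≤ K, π j ∉ U}) = 0 := by
    have : (⋂ K, {π : ℕ → S | ∀ j ≤ K, π j ∉ U}) = (reach U)ᶜ := by
      ext π
      simp only [Set.mem_iInter, Set.mem_ofPred_eq, reach, Set.mem_compl_iff, not_exists]
      exact ⟨fun h j => h j j le_rfl, fun h _ j _ => h j⟩
    rw [this, prob_compl_eq_zero_iff (measurableSet_reach U)]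
    exact h s
  rw [hzero] at hlim
  exact le_antisymm (ge_of_tendsto' hlim hle) zero_le

/-- Almost surely, a phase (b) that starts at time `K` ends. -/
theorem ae_b_ends (h : ∀ s, N.AlmostSure σ₁ s (reach U)) (K : ℕ) : ∀ (m : Phase S) (s : S),
    ∀ᵐ π ∂N.prob (σ₁.roundsFrom σ₂ T U n m) s, ∀ i, memory T U n m π K = .b i [] →
      ∃ k ≥ K, ¬(memory T U n m π k).IsB := by
  induction K with
  | zero =>
    intro m s
    by_cases hm : ∃ i, m.settle T U n s = .b i []
    · obtain ⟨i, hm⟩ := hm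
      filter_upwards [measure_eq_zero_iff_ae_notMem.1
        (prob_forall_isB_eq_zero (σ₂ := σ₂) h m s i hm)] with π hπ _ _
      simpa using hπ
    · filter_upwards [ae_zero_eq N _ s] with π hπ i hi
      rw [memory_zero, hπ] at hi
      exact absurd ⟨i, hi⟩ hm
  | succ K ih =>
    intro m s
    have hmeas : MeasurableSet {π : ℕ → S | ∀ i, memory T U n m π (K + 1) = .b i [] →
        ∃ k ≥ K + 1, ¬(memory T U n m π k).IsB} := by
      have : {π : ℕ → S | ∀ i, memory T U n m π (K + 1) = .b i [] →
          ∃ k ≥ K + 1, ¬(memory T U n m π k).IsB} =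
          {π | ∃ i, memory T U n m π (K + 1) = .b i []}ᶜ ∪
            ⋃ k, ⋃ _ : k ≥ K + 1, {π | ¬(memory T U n m π k).IsB} := by
        ext π
        simp only [Set.mem_ofPred_eq, Set.mem_union, Set.mem_compl_iff, Set.mem_iUnion, exists_prop]
        rw [← imp_iff_not_or, forall_exists_index]
      rw [this]
      exact (measurableSet_memory T U n m (K + 1) fun x => ∃ i, x = .b i []).compl.union
        (.iUnion fun k => .iUnion fun _ => measurableSet_memory T U n m k fun x => ¬x.IsB)
    refine ae_of_shift N _ s hmeas fun t _ => ?_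
    rw [shift_roundsFrom]
    filter_upwards [ih (m.step T U n s) t] with π hπ i hi
    rw [memory_cons_succ] at hi
    obtain ⟨k, hk, hb⟩ := hπ i hi
    exact ⟨k + 1, by omega, by rwa [memory_cons_succ]⟩

/-! ### Almost sure satisfaction of the second objective -/

theorem ae_infSet_rounds {p₁ p₂ : S → ℕ} {D : Set S} (h₁ : ∀ s, N.AlmostSure σ₁ s (reach U))
    (h₂ : N.IsSecondWitness p₁ p₂ σ₂ D) (hn : N.IsRoundLengths σ₂ T n) (s : S) :
    ∀ᵐ π ∂N.prob (σ₁.rounds σ₂ T U n) s, infSet π = D := by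
  have hedge : ∀ x y, N.next σ₂ [] x y ≠ 0 → ∀ᵐ π ∂N.prob (σ₁.rounds σ₂ T U n) s,
      (∀ K, ∃ k ≥ K, ¬(memory T U n (.a 0 []) π k).IsB ∧ π k = x) → y ∈ infSet π := by
    intro x y hxy
    refine ae_frequently N _ (fun ρ z =>
      ¬((ρ.foldl (Phase.step T U n) (.a 0 [])).settle T U n z).IsB ∧ z = x) y hxy ?_ s
    rintro ρ _ ⟨hb, rfl⟩
    rw [rounds_eq_roundsFrom, next_roundsFrom, phaseNext_of_not_isB h₂.1 hb]
  filter_upwards [ae_eventually_ne_b (U := U) (σ₁ := σ₁) hn h₂.1 s,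
    ae_all_iff.2 fun K => ae_b_ends (σ₂ := σ₂) (T := T) (n := n) h₁ K (.a 0 []) s,
    ae_mem_out N _ s,
    ae_all_iff.2 fun x => ae_all_iff.2 fun y =>
      ae_all_iff.2 fun hxy : N.next σ₂ [] x y ≠ 0 => hedge x y hxy] with π hJ hends hout hcl
  obtain ⟨K, hK⟩ := eventually_not_isB hJ hends
  rw [rounds_eq_roundsFrom, mem_out_roundsFrom_iff] at hout
  refine infSet_eq_of_closed (R := fun x y => N.next σ₂ [] x y ≠ 0) ⟨K, fun k hk => ?_⟩
    (fun x hx y hxy => hcl x y hxy fun K' => ?_) h₂.closed h₂.2.2.1.nonempty h₂.reachable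
  · rw [← phaseNext_of_not_isB h₂.1 (hK k hk)]
    exact hout.2 k
  · obtain ⟨k, hk, hx⟩ := hx (max K K')
    exact ⟨k, (le_max_right _ _).trans hk, hK k ((le_max_left _ _).trans hk), hx⟩

theorem almostSure_rounds {p₁ p₂ : S → ℕ} {D : Set S} (h₁ : ∀ s, N.AlmostSure σ₁ s (reach U))
    (h₂ : N.IsSecondWitness p₁ p₂ σ₂ D) (hn : N.IsRoundLengths σ₂ T n) (s : S) :
    N.AlmostSure (σ₁.rounds σ₂ T U n) s (parity p₂) := by
  rw [almostSure_parity_iff]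
  filter_upwards [ae_infSet_rounds h₁ h₂ hn s] with π hπ
  obtain ⟨x, hx⟩ := h₂.2.2.2.2.1
  exact mem_parity_of_maxEven (by rw [hπ]; exact hx.1) hx hπ.le

end Probability

/-! ### Strategies of a sub-MDP as strategies of the whole MDP -/

section Extend

variable {M : FinMDP S} {C : Set S} {hC : M.IsEC C}

theorem measurable_val_comp [MeasurableSpace S] :
    Measurable fun (π : ℕ → C) (i : ℕ) => (π i : S) := by
  fun_prop

theorem infSet_map (π : ℕ → C) : infSet (fun i => (π i : S)) = Subtype.val '' infSet π := by
  ext x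
  constructor
  · intro h
    obtain ⟨j, -, rfl⟩ := h 0
    refine ⟨π j, fun i => ?_, rfl⟩
    obtain ⟨k, hk, he⟩ := h i
    exact ⟨k, hk, Subtype.ext he⟩
  · rintro ⟨y, hy, rfl⟩ i
    obtain ⟨k, hk, rfl⟩ := hy i
    exact ⟨k, hk, rfl⟩

theorem map_mem_parity_iff (p : S → ℕ) (π : ℕ → C) :
    (fun i => (π i : S)) ∈ parity p ↔ π ∈ parity fun c : C => p c := by
  simp only [parity, Set.mem_ofPred_eq, infSet_map, Set.image_image]

theorem past_map (π : ℕ → C) (k : ℕ) :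
    past (fun i => (π i : S)) k = (past π k).map Subtype.val := by
  simp [past, List.map_ofFn, Function.comp_def]

theorem pmap_map_val (ρ : List C) (h : ∀ x ∈ ρ.map Subtype.val, x ∈ C) :
    (ρ.map Subtype.val).pmap Subtype.mk h = ρ := by
  induction ρ with
  | nil => rfl
  | cons a ρ ih => simpa using ih fun x hx => h x (List.mem_cons_of_mem _ hx)

theorem map_val_apply (p : PMF C) (c : C) : p.map Subtype.val (c : S) = p c := by
  rw [PMF.map_apply, tsum_eq_single c]
  · simp
  · intro d hd
    rw [if_neg fun h => hd (Subtype.ext h.symm)]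

theorem map_val_apply_of_notMem (p : PMF C) {t : S} (ht : t ∉ C) : p.map Subtype.val t = 0 := by
  rw [PMF.map_apply]
  refine ENNReal.tsum_eq_zero.2 fun c => if_neg ?_
  rintro rfl
  exact ht c.2

theorem map_restrictPMF (p : PMF S) (h : p.support ⊆ C) :
    (restrictPMF p C h).map Subtype.val = p := by
  ext t
  by_cases ht : t ∈ C
  · exact map_val_apply (restrictPMF p C h) ⟨t, ht⟩
  · rw [map_val_apply_of_notMem _ ht, eq_comm, PMF.apply_eq_zero_iff]
    exact fun hs => ht (h hs)

theorem next_extend (σ : (M.sub hC).Strategy) (ρ : List C) (s : C) :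
    M.next σ.extend (ρ.map Subtype.val) s = ((M.sub hC).next σ ρ s).map Subtype.val := by
  by_cases h : (s : S) ∈ M.S₁
  · have hs : s ∈ (M.sub hC).S₁ := h
    have hρ : (∀ x ∈ ρ.map Subtype.val, x ∈ C) ∧ (s : S) ∈ C := by
      refine ⟨fun x hx => ?_, s.2⟩
      obtain ⟨y, _, rfl⟩ := List.mem_map.1 hx
      exact y.2
    simp only [next, dif_pos h, dif_pos hs, Strategy.extend, dif_pos hρ, pmap_map_val]
  · have hs : s ∉ (M.sub hC).S₁ := h
    simp only [next, dif_neg h, dif_neg hs]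
    exact (map_restrictPMF (M.δ ⟨s, h⟩) (by
      rw [M.support_δ]
      exact fun t ht => hC.stochastic_closed s s.2 h t ht)).symm

theorem shift_extend (σ : (M.sub hC).Strategy) (s : C) :
    σ.extend.shift (s : S) = (σ.shift s).extend := by
  simp only [Strategy.shift, Strategy.extend, Strategy.mk.injEq]
  funext ρ u
  by_cases h : (∀ x ∈ ρ, x ∈ C) ∧ u ∈ C
  · have h' : (∀ x ∈ (s : S) :: ρ, x ∈ C) ∧ u ∈ C := by simpa using h
    rw [dif_pos h, dif_pos h']
    rfl
  · have h' : ¬((∀ x ∈ (s : S) :: ρ, x ∈ C) ∧ u ∈ C) := by simpa using h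
    rw [dif_neg h, dif_neg h']

/-- The plays of an extended strategy from a state of `C` are plays inside `C`. -/
theorem exists_of_mem_out_extend (σ : (M.sub hC).Strategy) (s : C) {π : ℕ → S}
    (hπ : π ∈ M.out σ.extend s) :
    ∃ w ∈ (M.sub hC).out σ s, π = fun i => (w i : S) := by
  classical
  rw [mem_out_iff] at hπ
  let w : ℕ → C := fun i => if h : π i ∈ C then ⟨π i, h⟩ else s
  have hw : ∀ i, π i ∈ C → (w i : S) = π i := fun i hi => by simp [w, hi]
  have hnext : ∀ n, (∀ i ≤ n, π i ∈ C) → M.next σ.extend (past π n) (π n) =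
      ((M.sub hC).next σ (past w n) (w n)).map Subtype.val := by
    intro n hn
    rw [past_congr (ρ := fun i => (w i : S)) fun i hi => (hw i (hn i hi.le)).symm,
      ← hw n (hn n le_rfl), past_map, next_extend]
  have hmem : ∀ n, ∀ i ≤ n, π i ∈ C := by
    intro n
    induction n with
    | zero =>
      intro i hi
      obtain rfl : i = 0 := by omega
      rw [hπ.1]
      exact s.2
    | succ n ih =>
      intro i hi
      rcases Nat.eq_or_lt_of_le hi with rfl | hi
      · by_contra hc
        refine hπ.2 n ?_
        rw [hnext n ih, map_val_apply_of_notMem _ hc]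
      · exact ih i (by omega)
  refine ⟨w, ?_, funext fun i => (hw i (hmem i i le_rfl)).symm⟩
  rw [mem_out_iff]
  refine ⟨Subtype.ext ((hw 0 (hmem 0 0 le_rfl)).trans hπ.1), fun n => ?_⟩
  have := hπ.2 n
  rwa [hnext n (hmem n), ← hw (n + 1) (hmem _ _ le_rfl), map_val_apply] at this

theorem sure_extend {σ : (M.sub hC).Strategy} {s : C} {p : S → ℕ}
    (h : (M.sub hC).Sure σ s (parity fun c : C => p c)) : M.Sure σ.extend s (parity p) := by
  intro π hπ
  obtain ⟨w, hw, rfl⟩ := exists_of_mem_out_extend σ s hπ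
  exact (map_mem_parity_iff p w).2 (h hw)

variable [Finite S] [MeasurableSpace S] [MeasurableSingletonClass S]

/-- The law of the play under an extended strategy is the image of the law in the sub-MDP. -/
theorem prob_extend (σ : (M.sub hC).Strategy) (s : C) :
    M.prob σ.extend s = ((M.sub hC).prob σ s).map fun π i => (π i : S) := by
  have hι := measurable_val_comp (C := C)
  have : IsProbabilityMeasure (((M.sub hC).prob σ s).map fun π i => (π i : S)) :=
    Measure.isProbabilityMeasure_map hι.aemeasurable
  refine measure_ext_cyl fun w n => ?_
  rw [Measure.map_apply hι (measurableSet_cyl w n)]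
  clear this
  induction n generalizing σ s w with
  | zero =>
    rw [prob_cyl]
    split
    · next h =>
      rw [Finset.range_zero, Finset.prod_empty, mul_one, eq_comm,
        ← mem_ae_iff_prob_eq_one (hι (measurableSet_cyl w 0))]
      filter_upwards [ae_zero_eq (M.sub hC) σ s] with π hπ i hi
      obtain rfl : i = 0 := by omega
      exact (congrArg Subtype.val hπ).trans h.symm
    · next h =>
      rw [zero_mul, eq_comm]
      refine measure_mono_null ?_ (ae_iff.1 (ae_zero_eq (M.sub hC) σ s))
      intro π hπ h0
      exact h ((hπ 0 le_rfl).symm.trans (congrArg Subtype.val h0))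
  | succ n ih =>
    rw [prob_apply M _ _ (measurableSet_cyl w (n + 1)),
      prob_apply _ _ _ (hι (measurableSet_cyl w (n + 1)))]
    have hcons : ∀ A : Set (ℕ → S), cons s ⁻¹' ((fun (π : ℕ → C) (i : ℕ) => (π i : S)) ⁻¹' A) =
        (fun (π : ℕ → C) (i : ℕ) => (π i : S)) ⁻¹' (cons (s : S) ⁻¹' A) := by
      intro A
      ext π
      have : (fun i => ((cons s π i : C) : S)) = cons (s : S) fun i => (π i : S) := by
        funext i
        cases i <;> rfl
      simp only [Set.mem_preimage, this]
    have hnext := next_extend σ [] s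
    rw [List.map_nil] at hnext
    rw [hnext, ← tsum_subtype_eq_of_support_subset (s := C)]
    · refine tsum_congr fun t => ?_
      rw [map_val_apply, hcons, shift_extend]
      congr 1
      by_cases hw : w 0 = s
      · rw [cons_preimage_cyl_succ w n _ hw, ih]
      · have : cons (s : S) ⁻¹' cyl w (n + 1) = ∅ :=
          Set.eq_empty_of_forall_notMem fun π hπ => hw (hπ 0 (Nat.zero_le _)).symm
        simp [this]
    · intro t ht
      by_contra hc
      exact ht (by simp [map_val_apply_of_notMem _ hc])

theorem almostSure_extend {σ : (M.sub hC).Strategy} {s : C} {p : S → ℕ}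
    (h : (M.sub hC).AlmostSure σ s (parity fun c : C => p c)) :
    M.AlmostSure σ.extend s (parity p) := by
  rw [almostSure_parity_iff] at h ⊢
  rw [prob_extend]
  refine (ae_map_iff (p := fun π => π ∈ parity p) measurable_val_comp.aemeasurable
    (measurableSet_parity p)).2 ?_
  filter_upwards [h] with π hπ
  exact (map_mem_parity_iff p π).2 hπ

end Extend

theorem reflTransGen_sub {M : FinMDP S} {C : Set S} (hC : M.IsEC C) (s t : C) :
    Relation.ReflTransGen (M.sub hC).E s t := by
  obtain ⟨t, ht⟩ := t
  have h := hC.connected s s.2 t ht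
  suffices H : ∀ ht : t ∈ C, Relation.ReflTransGen (M.sub hC).E s ⟨t, ht⟩ from H _
  clear ht
  induction h with
  | refl => exact fun _ => .refl
  | tail _ h ih => exact fun ht => (ih h.1).tail h.2.2

end FinMDP

theorem lemma7 {S : Type*} [Finite S] [MeasurableSpace S] [MeasurableSingletonClass S]
    (M : FinMDP S) (p₁ p₂ : S → ℕ) (C : Set S) (hC : M.IsEC C)
    (hU : M.IsUltraGood p₁ p₂ hC) :
    (∃ (σ₁ σ₂ : (M.sub hC).Strategy) (D : Set C) (n : ℕ → ℕ),
      (M.sub hC).IsFirstWitness (fun c : C => p₁ c) σ₁ ∧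
      (M.sub hC).IsSecondWitness (fun c : C => p₁ c) (fun c : C => p₂ c) σ₂ D ∧
      (M.sub hC).IsRoundLengths σ₂ (FinMDP.maxEven (fun c : C => p₁ c) D) n) ∧
    ∀ (σ₁ σ₂ : (M.sub hC).Strategy) (D : Set C) (n : ℕ → ℕ),
      (M.sub hC).IsFirstWitness (fun c : C => p₁ c) σ₁ →
      (M.sub hC).IsSecondWitness (fun c : C => p₁ c) (fun c : C => p₂ c) σ₂ D →
      (M.sub hC).IsRoundLengths σ₂ (FinMDP.maxEven (fun c : C => p₁ c) D) n →
      ∀ (s : C) (σ : (M.sub hC).Strategy),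
        σ = σ₁.rounds σ₂ (FinMDP.maxEven (fun c : C => p₁ c) D)
          (FinMDP.maxEven (fun c : C => p₁ c) Set.univ) n →
        ((M.sub hC).Sure σ s (FinMDP.parity fun c : C => p₁ c) ∧
          (M.sub hC).AlmostSure σ s (FinMDP.parity fun c : C => p₂ c)) ∧
        (M.Sure σ.extend s (FinMDP.parity p₁) ∧
          M.AlmostSure σ.extend s (FinMDP.parity p₂)) := by
  have : Nonempty C := hC.nonempty.to_subtype
  refine ⟨?_, ?_⟩
  · obtain ⟨σ₁, h₁⟩ := FinMDP.exists_isFirstWitness (M.sub hC) (fun c : C => p₁ c) hU.1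
    obtain ⟨σ₂, D, h₂⟩ := FinMDP.exists_isSecondWitness (M.sub hC) (fun c : C => p₁ c)
      (fun c : C => p₂ c) (FinMDP.reflTransGen_sub hC) hU.2
    obtain ⟨n, hn⟩ := FinMDP.exists_isRoundLengths (M.sub hC) σ₂
      (FinMDP.maxEven (fun c : C => p₁ c) D) fun s => by
        filter_upwards [h₂.ae_infSet_eq s] with π hπ
        obtain ⟨x, hx⟩ := h₂.2.2.2.1
        have hxD := hx.1
        rw [← hπ] at hxD
        obtain ⟨k, -, hk⟩ := hxD 0
        exact ⟨k, by rw [hk]; exact hx⟩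
    exact ⟨σ₁, σ₂, D, n, h₁, h₂, hn⟩
  · rintro σ₁ σ₂ D n h₁ h₂ hn s σ rfl
    have hsure := FinMDP.sure_rounds n (fun s => (h₁ s).1) h₂ s
    have has := FinMDP.almostSure_rounds (fun s => (h₁ s).2) h₂ hn s
    exact ⟨⟨hsure, has⟩, FinMDP.sure_extend hsure, FinMDP.almostSure_extend has⟩
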